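/- There are absolute constants $C, c, K > 0$ such that the following holds for all integers $d \ge 3$ and $n \ge 2$. The group $\mathrm{SL}(n)^d$ of $d$-tuples of complex $n\times n$ matrices of determinant one acts simultaneously on $n$-tuples of tensors $w = (w_1, \dots, w_n) \in ((\mathbb{C}^n)^{\otimes d})^n$ by $(g\cdot w)_l = (g_1 \otimes \cdots \otimes g_d)\, w_l$. Write $\|w\|^2 = \sum_l \|w_l\|^2$ for the standard Hermitian norm and $\mathrm{cap}(w) = \inf_{g \in \mathrm{SL}(n)^d} \|g \cdot w\|^2$ for the capacity. For $R \ge 0$ the geodesic ball of radius $R$ about the identity is $$B_R = \mathrm{SL}(n)^d \cap \{U e^{A} : U = (U_1,\dots,U_d) \text{ unitary},\ A = (A_1, \dots, A_d) \text{ Hermitian},\ \|A\|_F \le R\},$$ where $\|A\|_F^2 = \sum_k \|A_k\|_F^2$ and products and exponentials of tuples are taken componentwise. For every $\varepsilon$ with $0 < \varepsilon \le \exp(-C n^2 \log n)$ there is a tuple $w = w(\varepsilon) \in ((\mathbb{C}^n)^{\otimes d})^n$ with at most $K n^2$ nonzero entries (in the standard basis), each of them a Gaussian rational number of bit complexity at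 most $K(\log n + \log(1/\varepsilon))$ (the number of bits needed to write the real and imaginary parts as signed fractions in lowest terms), and a radius $R \ge c\, 2^{n/3} \log(1/\varepsilon)$, such that $$\inf_{g \in B_R} \|g \cdot w\|^2 \ \ge\ \mathrm{cap}(w) + \varepsilon .$$ Moreover, $1/4 \le \mathrm{cap}(w) \le 1$ and $1/2 \le \|w\| \le 1$. -/

import Mathlib

namespace TensorScaling

/-- Tensors in `(ℂ^n)^{⊗d}`, given by their entries in the standard basis
`e_{i_1} ⊗ ⋯ ⊗ e_{i_d}`, with the standard Hermitian norm. -/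
abbrev Tensor (n d : ℕ) : Type := EuclideanSpace ℂ (Fin d → Fin n)

/-- `m`-tuples of tensors, i.e. `((ℂ^n)^{⊗d})^m`, with `‖w‖² = ∑ l, ‖w l‖²`. -/
abbrev TensorTuple (m n d : ℕ) : Type := PiLp 2 (fun _ : Fin m => Tensor n d)

/-- The group `SL(n)^d` of `d`-tuples of complex matrices of determinant one. -/
abbrev SLPow (n d : ℕ) : Type := Fin d → Matrix.SpecialLinearGroup (Fin n) ℂ

/-- The matrix of `g_1 ⊗ ⋯ ⊗ g_d` in the standard basis of `(ℂ^n)^{⊗d}`. -/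
def tensorMatrix {n d : ℕ} (g : SLPow n d) : Matrix (Fin d → Fin n) (Fin d → Fin n) ℂ :=
  Matrix.of fun i j => ∏ k, (g k : Matrix (Fin n) (Fin n) ℂ) (i k) (j k)

/-- The tensor scaling action `g · v = (g_1 ⊗ ⋯ ⊗ g_d) v`. -/
noncomputable def act {n d : ℕ} (g : SLPow n d) (v : Tensor n d) : Tensor n d :=
  WithLp.toLp 2 ((tensorMatrix g).mulVec (fun i => v i))

/-- The simultaneous action on tuples, `(g · w)_l = g · w_l`. -/
noncomputable def actTuple {m n d : ℕ} (g : SLPow n d) (w : TensorTuple m n d) :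
    TensorTuple m n d :=
  WithLp.toLp 2 fun l => act g (w l)

/-- The elementary tensor `x_1 ⊗ ⋯ ⊗ x_d`. -/
noncomputable def pureTensor {n d : ℕ} (x : Fin d → Fin n → ℂ) : Tensor n d :=
  WithLp.toLp 2 fun i => ∏ k, x k (i k)

/-- The action is the tensor product action: on elementary tensors it is
`x_1 ⊗ ⋯ ⊗ x_d ↦ g_1 x_1 ⊗ ⋯ ⊗ g_d x_d`. -/
theorem act_pureTensor {n d : ℕ} (g : SLPow n d) (x : Fin d → Fin n → ℂ) :
    act g (pureTensor x) =
      pureTensor fun k => (g k : Matrix (Fin n) (Fin n) ℂ).mulVec (x k) := by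
  ext i
  simp only [act, pureTensor, tensorMatrix, Matrix.mulVec, dotProduct, Matrix.of_apply,
    ← Finset.prod_mul_distrib]
  rw [Finset.prod_univ_sum, Fintype.piFinset_univ]

/-- The capacity of a tuple of tensors under `SL(n)^d`: the infimum of `‖g · w‖²`. -/
noncomputable def capacity {m n d : ℕ} (w : TensorTuple m n d) : ℝ :=
  ⨅ g : SLPow n d, ‖actTuple g w‖ ^ 2

/-- The Frobenius norm of a tuple of matrices, viewed as a block diagonal matrix. -/
noncomputable def frobeniusNorm {n d : ℕ} (A : Fin d → Matrix (Fin n) (Fin n) ℂ) : ℝ :=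
  Real.sqrt (∑ k, ∑ i, ∑ j, ‖A k i j‖ ^ 2)

/-- The geodesic ball of radius `R` about the identity in `SL(n)^d`: the elements of `SL(n)^d`
of the form `U exp(A)` with `U` a tuple of unitary matrices and `A` a tuple of Hermitian matrices
with `‖A‖_F ≤ R`. -/
def geodesicBall (n d : ℕ) (R : ℝ) : Set (SLPow n d) :=
  {g | ∃ U A : Fin d → Matrix (Fin n) (Fin n) ℂ,
    (∀ k, U k ∈ Matrix.unitaryGroup (Fin n) ℂ) ∧ (∀ k, (A k).IsHermitian) ∧
    frobeniusNorm A ≤ R ∧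
    ∀ k, (g k : Matrix (Fin n) (Fin n) ℂ) = U k * NormedSpace.exp (A k)}

/-- The number of nonzero entries of a tuple of tensors. -/
noncomputable def numNonzero {m n d : ℕ} (w : TensorTuple m n d) : ℕ :=
  Set.ncard {p : Fin m × (Fin d → Fin n) | w p.1 p.2 ≠ 0}

/-- The number of bits used to write a rational number in lowest terms: one bit for the sign and
the binary digits of numerator and denominator. -/
def ratBits (q : ℚ) : ℕ := 1 + Nat.size q.num.natAbs + Nat.size q.den

/-- `z` is a Gaussian rational whose real and imaginary part are together written with at most
`b` bits. -/
def BitComplexityLE (z : ℂ) (b : ℝ) : Prop :=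
  ∃ p q : ℚ, z = (p : ℂ) + (q : ℂ) * Complex.I ∧ ((ratBits p + ratBits q : ℕ) : ℝ) ≤ b

end TensorScaling

/-! For a free tuple the whole orbit is controlled from the diagonal torus. Given `g` in the ball
and real diagonal `D_k` of trace zero, write `g_k^* g_k = exp(D_k) exp(X_k) exp(D_k)` with `X_k`
Hermitian of trace zero. Since `⊗ exp(X_k) ≥ 1 + ∑ X_k`, with `X_k` acting in the factor `k`, the
norm `‖g · w‖²` is bounded below by a first-order expansion at `exp D · w`. Freeness lets only the
diagonals of the `X_k` enter, and Jensen's inequality puts these within `2R` of `-2 D_k`. The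
outcome is `norm_sq_actTuple_ge`, whose error term is `2R` times the `ℓ¹` distance of the marginals
of the squared entries of `exp D · w` from uniform ones.

Suppose the support lies in two hyperplanes, `pairing D = 0` and `pairing D = -h`. Moving along `D`
to infinity removes the second part, so the capacity is at most the mass of the first, while `exp D
· w` still carries mass `η` on the second. By `capacity_add_le_iInf_geodesicBall` the ball does not
get below `cap + η` as long as `R` times the marginal defect is at most `h η`. A large radius thus
needs a defect exponentially smaller than `η`.

The chain construction on `n = 3(m+1) + r` indices provides this. A functional with values `±2^i`
vanishes on all positions except `(1,1,1)`. The mass `η` there is compensated along the chain with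
halving at every link, so that a single index keeps a defect `η / 2^m`. The special entry starts
near `α = 1/(2n²)` and decays to `η = ε/n`, which makes `h` of order `log(1/ε)`. The `n` members `z
⊗ e_l ⊗ ⋯ ⊗ e_l` extend order three to order `d` with balanced extra factors.

The lower bound on the capacity comes from `le_capacity_of_uniform_marginals`: the same gradient
bound at almost critical torus points shows that the torus infimum already bounds the orbit, and
there `exp x ≥ 1 + x` suffices. The case `n = 2` is a separate explicit pair. -/

namespace TensorScaling

open Matrix Finset
open scoped ComplexOrder

/-! ### Tensor products of matrices and their quadratic forms. -/

/-- The matrix of `h_1 ⊗ ⋯ ⊗ h_d`. -/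
def tensorProd {n d : ℕ} (h : Fin d → Matrix (Fin n) (Fin n) ℂ) :
    Matrix (Fin d → Fin n) (Fin d → Fin n) ℂ :=
  Matrix.of fun i j => ∏ k, h k (i k) (j k)

theorem tensorProd_mul {n d : ℕ} (h h' : Fin d → Matrix (Fin n) (Fin n) ℂ) :
    tensorProd h * tensorProd h' = tensorProd fun k => h k * h' k := by
  ext i j
  simp only [tensorProd, Matrix.mul_apply, Matrix.of_apply, ← Finset.prod_mul_distrib]
  rw [Finset.prod_univ_sum, Fintype.piFinset_univ]

theorem tensorProd_conjTranspose {n d : ℕ} (h : Fin d → Matrix (Fin n) (Fin n) ℂ) :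
    (tensorProd h)ᴴ = tensorProd fun k => (h k)ᴴ := by
  ext i j
  simp [tensorProd, Matrix.conjTranspose_apply]

theorem tensorProd_diagonal {n d : ℕ} (x : Fin d → Fin n → ℂ) :
    tensorProd (fun k => Matrix.diagonal (x k)) =
      Matrix.diagonal fun i => ∏ k, x k (i k) := by
  ext i j
  simp only [tensorProd, Matrix.of_apply, Matrix.diagonal_apply]
  split_ifs with hij
  · subst hij; simp
  · obtain ⟨k, hk⟩ := Function.ne_iff.mp hij
    exact Finset.prod_eq_zero (Finset.mem_univ k) (by simp [hk])

theorem tensorProd_one {n d : ℕ} :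
    tensorProd (fun _ : Fin d => (1 : Matrix (Fin n) (Fin n) ℂ)) = 1 := by
  have := tensorProd_diagonal (n := n) (d := d) fun _ _ => 1
  simpa using this

theorem tensorProd_update_one_apply {n d : ℕ} (k : Fin d) (L : Matrix (Fin n) (Fin n) ℂ)
    (i j : Fin d → Fin n) :
    tensorProd (Function.update (fun _ => 1) k L) i j =
      if ∀ k', k' ≠ k → i k' = j k' then L (i k) (j k) else 0 := by
  simp only [tensorProd, Matrix.of_apply]
  split_ifs with hij
  · rw [Finset.prod_eq_single k]
    · simp
    · intro k' _ hk'
      rw [Function.update_of_ne hk', hij k' hk', Matrix.one_apply_eq]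
    · simp
  · push Not at hij
    obtain ⟨k', hk', hne⟩ := hij
    refine Finset.prod_eq_zero (Finset.mem_univ k') ?_
    rw [Function.update_of_ne hk', Matrix.one_apply_ne hne]

theorem dotProduct_mulVec_conj_diagonal {ι : Type*} [Fintype ι] [DecidableEq ι]
    (W : Matrix ι ι ℂ) (x : ι → ℝ) (v : ι → ℂ) :
    star v ⬝ᵥ ((W * Matrix.diagonal (fun j => (x j : ℂ)) * Wᴴ) *ᵥ v) =
      ((∑ j, x j * ‖(Wᴴ *ᵥ v) j‖ ^ 2 : ℝ) : ℂ) := by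
  rw [Matrix.mul_assoc, ← Matrix.mulVec_mulVec, ← Matrix.mulVec_mulVec, Matrix.dotProduct_mulVec]
  have : star v ᵥ* W = star (Wᴴ *ᵥ v) := by
    rw [Matrix.star_mulVec, Matrix.conjTranspose_conjTranspose]
  rw [this]
  simp only [dotProduct, Matrix.mulVec_diagonal, Pi.star_apply]
  push_cast
  refine Finset.sum_congr rfl fun j _ => ?_
  rw [← Complex.conj_mul', RCLike.star_def]
  ring

theorem tensorProd_conj {n d : ℕ} (U X : Fin d → Matrix (Fin n) (Fin n) ℂ) :
    tensorProd U * tensorProd X * (tensorProd U)ᴴ =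
      tensorProd fun k => U k * X k * (U k)ᴴ := by
  rw [tensorProd_conjTranspose, tensorProd_mul, tensorProd_mul]

/-- The single unitary `⊗ U_k` diagonalizes every one-factor operator together with the full tensor
product, so comparing them becomes a scalar question. -/
theorem tensorProd_update_conj {n d : ℕ} (U : Fin d → Matrix (Fin n) (Fin n) ℂ)
    (hU : ∀ k, U k * (U k)ᴴ = 1) (k : Fin d) (x : Fin n → ℂ) :
    tensorProd (Function.update (fun _ => 1) k (U k * Matrix.diagonal x * (U k)ᴴ)) =
      tensorProd U * Matrix.diagonal (fun j => x (j k)) * (tensorProd U)ᴴ := by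
  have h1 : Matrix.diagonal (fun j : Fin d → Fin n => x (j k)) =
      tensorProd (Function.update (fun _ => 1) k (Matrix.diagonal x)) := by
    have := tensorProd_diagonal (n := n) (d := d) (Function.update (fun _ _ => 1) k x)
    have h2 : (fun k' => Matrix.diagonal (Function.update (fun _ _ => (1 : ℂ)) k x k')) =
        Function.update (fun _ : Fin d => (1 : Matrix (Fin n) (Fin n) ℂ)) k
          (Matrix.diagonal x) := by
      funext k'
      by_cases h : k' = k
      · subst h; simp
      · simp [Function.update_of_ne h]
    rw [h2] at this
    rw [this]
    congr 1
    funext j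
    rw [Finset.prod_eq_single k]
    · simp
    · intro k' _ hk'; rw [Function.update_of_ne hk']
    · simp
  rw [h1, tensorProd_conj]
  congr 1
  funext k'
  by_cases h : k' = k
  · subst h; simp
  · simp [Function.update_of_ne h, hU]

/-- The inequality `⊗ H_k ≥ 1 + ∑ log H_k` for positive definite matrices `H_k`, as quadratic
forms. -/
theorem sum_add_log_le_dotProduct_tensorProd {n d : ℕ} (U : Fin d → Matrix (Fin n) (Fin n) ℂ)
    (hU : ∀ k, U k * (U k)ᴴ = 1) (x : Fin d → Fin n → ℝ) (v : (Fin d → Fin n) → ℂ) :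
    ∑ i, ‖v i‖ ^ 2 + ∑ k, (star v ⬝ᵥ (tensorProd (Function.update (fun _ => 1) k
        (U k * Matrix.diagonal (fun a => (x k a : ℂ)) * (U k)ᴴ)) *ᵥ v)).re ≤
      (star v ⬝ᵥ (tensorProd (fun k => U k * Matrix.diagonal
        (fun a => ((Real.exp (x k a) : ℝ) : ℂ)) * (U k)ᴴ) *ᵥ v)).re := by
  have hW : tensorProd U * (tensorProd U)ᴴ = 1 := by
    rw [tensorProd_conjTranspose, tensorProd_mul, ← tensorProd_one]
    simp_rw [hU]
  set y := (tensorProd U)ᴴ *ᵥ v with hy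
  have h1 : ∑ i, ‖v i‖ ^ 2 = ∑ j, ‖y j‖ ^ 2 := by
    have := dotProduct_mulVec_conj_diagonal (tensorProd U) (fun _ => 1) v
    have h2 : Matrix.diagonal (fun _ : Fin d → Fin n => ((1 : ℝ) : ℂ)) = 1 := by simp
    rw [h2, mul_one, hW, one_mulVec] at this
    have h3 : star v ⬝ᵥ v = ((∑ i, ‖v i‖ ^ 2 : ℝ) : ℂ) := by
      simp only [dotProduct, Pi.star_apply]
      push_cast
      exact Finset.sum_congr rfl fun i _ => by rw [← Complex.conj_mul', RCLike.star_def]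
    rw [h3] at this
    simpa using (Complex.ofReal_injective this)
  have h2 : ∀ k, (star v ⬝ᵥ (tensorProd (Function.update (fun _ => 1) k
        (U k * Matrix.diagonal (fun a => (x k a : ℂ)) * (U k)ᴴ)) *ᵥ v)).re =
      ∑ j, x k (j k) * ‖y j‖ ^ 2 := by
    intro k
    rw [tensorProd_update_conj U hU,
      dotProduct_mulVec_conj_diagonal (tensorProd U) (fun j => x k (j k)), Complex.ofReal_re]
  have h3 : (star v ⬝ᵥ (tensorProd (fun k => U k * Matrix.diagonal
        (fun a => ((Real.exp (x k a) : ℝ) : ℂ)) * (U k)ᴴ) *ᵥ v)).re =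
      ∑ j, Real.exp (∑ k, x k (j k)) * ‖y j‖ ^ 2 := by
    rw [← tensorProd_conj U, tensorProd_diagonal]
    have : (fun i : Fin d → Fin n => ∏ k, ((Real.exp (x k (i k)) : ℝ) : ℂ)) =
        fun i => ((Real.exp (∑ k, x k (i k)) : ℝ) : ℂ) := by
      funext i
      rw [Real.exp_sum, Complex.ofReal_prod]
    rw [this, dotProduct_mulVec_conj_diagonal, Complex.ofReal_re]
  -- In the common eigenbasis the claim is `1 + s ≤ exp s` with `s = ∑ k, x k (j k)`.
  rw [h1, h3, Finset.sum_congr rfl fun k _ => h2 k, Finset.sum_comm, ← Finset.sum_add_distrib]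
  refine Finset.sum_le_sum fun j _ => ?_
  rw [← Finset.sum_mul, ← one_add_mul]
  refine mul_le_mul_of_nonneg_right ?_ (sq_nonneg _)
  linarith [Real.add_one_le_exp (∑ k, x k (j k))]

/-! ### Free tuples and norms along the orbit. -/

/-- A tuple of tensors is free if distinct positions of the support of any of its members differ
in at least two coordinates. -/
def IsFree {m n d : ℕ} (w : TensorTuple m n d) : Prop :=
  ∀ (l : Fin m) (i j : Fin d → Fin n), w l i ≠ 0 → w l j ≠ 0 →
    ∀ k, (∀ k', k' ≠ k → i k' = j k') → i = j

/-- An operator acting in the factor `k` only couples positions that agree outside `k`; freeness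
forces these to coincide, so off-diagonal entries of `L` drop out. -/
theorem dotProduct_update_of_free {n d : ℕ} (v : (Fin d → Fin n) → ℂ) (k : Fin d)
    (hv : ∀ i j : Fin d → Fin n, v i ≠ 0 → v j ≠ 0 → (∀ k', k' ≠ k → i k' = j k') → i = j)
    (L : Matrix (Fin n) (Fin n) ℂ) :
    star v ⬝ᵥ (tensorProd (Function.update (fun _ => 1) k L) *ᵥ v) =
      ∑ i, (‖v i‖ ^ 2 : ℝ) * L (i k) (i k) := by
  simp only [dotProduct, Matrix.mulVec, Pi.star_apply]
  refine Finset.sum_congr rfl fun i _ => ?_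
  by_cases hi : v i = 0
  · simp [hi]
  rw [Finset.sum_eq_single i]
  · rw [tensorProd_update_one_apply, if_pos fun _ _ => rfl]
    push_cast
    rw [← Complex.conj_mul', RCLike.star_def]
    ring
  · intro j _ hj
    rw [tensorProd_update_one_apply]
    split_ifs with h
    · by_cases hj0 : v j = 0
      · simp [hj0]
      · exact absurd (hv i j hi hj0 h).symm hj
    · simp
  · simp

theorem norm_sq_act {n d : ℕ} (g : SLPow n d) (v : Tensor n d) :
    ‖act g v‖ ^ 2 = (star (fun i => v i) ⬝ᵥ (tensorProd (fun k =>
      (g k : Matrix (Fin n) (Fin n) ℂ)ᴴ * (g k : Matrix (Fin n) (Fin n) ℂ)) *ᵥ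
        fun i => v i)).re := by
  rw [← tensorProd_mul, ← tensorProd_conjTranspose, ← Matrix.mulVec_mulVec,
    Matrix.dotProduct_mulVec, ← Matrix.star_mulVec, EuclideanSpace.norm_sq_eq]
  simp only [dotProduct, Pi.star_apply, Complex.re_sum]
  refine Finset.sum_congr rfl fun i _ => ?_
  rw [RCLike.star_def, Complex.conj_mul', ← Complex.ofReal_pow, Complex.ofReal_re]
  rfl

theorem norm_sq_tuple {m n d : ℕ} (w : TensorTuple m n d) : ‖w‖ ^ 2 = ∑ l, ‖w l‖ ^ 2 :=
  PiLp.norm_sq_eq_of_L2 _ w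

/-! ### Logarithms of positive definite matrices and their diagonals. -/

/-- Every matrix `h` with `|det h| = 1` has `h^* h = exp X` with `X` Hermitian of trace zero;
here `X` is given by its spectral decomposition. -/
theorem exists_spectral_log {n : ℕ} (h : Matrix (Fin n) (Fin n) ℂ) (hdet : ‖h.det‖ = 1) :
    ∃ (U : Matrix (Fin n) (Fin n) ℂ) (x : Fin n → ℝ), U * Uᴴ = 1 ∧
      hᴴ * h = U * Matrix.diagonal (fun a => ((Real.exp (x a) : ℝ) : ℂ)) * Uᴴ ∧
      ∑ a, x a = 0 := by
  have hu : IsUnit h := by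
    rw [Matrix.isUnit_iff_isUnit_det]
    exact IsUnit.mk0 _ fun h0 => by simp [h0] at hdet
  have hP : (hᴴ * h).PosDef := Matrix.PosDef.conjTranspose_mul_self h (Matrix.mulVec_injective_of_isUnit hu)
  have hlog : ∀ a, Real.exp (Real.log (hP.isHermitian.eigenvalues a)) =
      hP.isHermitian.eigenvalues a := fun a => Real.exp_log (hP.eigenvalues_pos a)
  refine ⟨hP.isHermitian.eigenvectorUnitary, fun a => Real.log (hP.isHermitian.eigenvalues a),
    ?_, ?_, ?_⟩
  · exact Unitary.coe_mul_star_self _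
  · simp_rw [hlog]
    have := hP.isHermitian.spectral_theorem
    rw [Unitary.conjStarAlgAut_apply] at this
    exact this
  · rw [← Real.log_prod fun a _ => (hP.eigenvalues_pos a).ne']
    have h1 := hP.isHermitian.det_eq_prod_eigenvalues
    have h2 : (hᴴ * h).det = 1 := by
      rw [Matrix.det_mul, Matrix.det_conjTranspose, RCLike.star_def, Complex.conj_mul', hdet]
      simp
    rw [h2] at h1
    have h3 : ∏ a, hP.isHermitian.eigenvalues a = 1 := by
      have : ((∏ a, hP.isHermitian.eigenvalues a : ℝ) : ℂ) = 1 := by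
        rw [Complex.ofReal_prod]; exact h1.symm
      exact_mod_cast this
    rw [h3, Real.log_one]

theorem conj_diagonal_apply_self {n : ℕ} (U : Matrix (Fin n) (Fin n) ℂ) (y : Fin n → ℝ)
    (a : Fin n) : (U * Matrix.diagonal (fun j => (y j : ℂ)) * Uᴴ) a a =
      ((∑ j, ‖U a j‖ ^ 2 * y j : ℝ) : ℂ) := by
  rw [Matrix.mul_apply]
  push_cast
  refine Finset.sum_congr rfl fun j _ => ?_
  rw [Matrix.mul_diagonal, Matrix.conjTranspose_apply, ← Complex.mul_conj', RCLike.star_def]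
  ring

theorem sum_norm_sq_row_eq_one {n : ℕ} (U : Matrix (Fin n) (Fin n) ℂ) (hU : U * Uᴴ = 1)
    (a : Fin n) : ∑ j, ‖U a j‖ ^ 2 = 1 := by
  have h := conj_diagonal_apply_self U (fun _ => 1) a
  have h1 : Matrix.diagonal (fun _ : Fin n => ((1 : ℝ) : ℂ)) = 1 := by simp
  rw [h1, mul_one, hU, Matrix.one_apply_eq] at h
  have : ((∑ j, ‖U a j‖ ^ 2 * 1 : ℝ) : ℂ) = ((1 : ℝ) : ℂ) := by rw [← h]; simp
  simpa using Complex.ofReal_injective this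

theorem inv_conj_diagonal_exp {n : ℕ} (U : Matrix (Fin n) (Fin n) ℂ) (hU : U * Uᴴ = 1)
    (x : Fin n → ℝ) :
    (U * Matrix.diagonal (fun a => ((Real.exp (x a) : ℝ) : ℂ)) * Uᴴ)⁻¹ =
      U * Matrix.diagonal (fun a => ((Real.exp (-x a) : ℝ) : ℂ)) * Uᴴ := by
  have hU' : Uᴴ * U = 1 := mul_eq_one_comm.mp hU
  refine Matrix.inv_eq_right_inv ?_
  rw [show U * Matrix.diagonal (fun a => ((Real.exp (x a) : ℝ) : ℂ)) * Uᴴ *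
      (U * Matrix.diagonal (fun a => ((Real.exp (-x a) : ℝ) : ℂ)) * Uᴴ) =
      U * (Matrix.diagonal (fun a => ((Real.exp (x a) : ℝ) : ℂ)) * (Uᴴ * U) *
        Matrix.diagonal (fun a => ((Real.exp (-x a) : ℝ) : ℂ))) * Uᴴ by
    simp only [Matrix.mul_assoc], hU', mul_one, Matrix.diagonal_mul_diagonal]
  have : (fun a => ((Real.exp (x a) : ℝ) : ℂ) * ((Real.exp (-x a) : ℝ) : ℂ)) = fun _ => 1 := by
    funext a
    rw [← Complex.ofReal_mul, ← Real.exp_add]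
    simp
  rw [this, Matrix.diagonal_one, mul_one, hU]

/-- Jensen's inequality for the diagonal entries of a logarithm. -/
theorem sum_row_mul_le_of_exp_le {n : ℕ} (U : Matrix (Fin n) (Fin n) ℂ) (hU : U * Uᴴ = 1)
    (x : Fin n → ℝ) (a : Fin n) (r : ℝ)
    (h : ∑ j, ‖U a j‖ ^ 2 * Real.exp (x j) ≤ Real.exp r) :
    ∑ j, ‖U a j‖ ^ 2 * x j ≤ r := by
  have h1 := sum_norm_sq_row_eq_one U hU a
  have h2 : ∑ j, ‖U a j‖ ^ 2 * x j ≤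
      ∑ j, (‖U a j‖ ^ 2 * Real.exp (x j) * Real.exp (-r) + ‖U a j‖ ^ 2 * (r - 1)) := by
    refine Finset.sum_le_sum fun j _ => ?_
    rw [mul_assoc, ← Real.exp_add, ← mul_add]
    refine mul_le_mul_of_nonneg_left ?_ (sq_nonneg _)
    -- Tangent line of `exp` at `r`, in the form `x ≤ exp (x - r) + r - 1`; averaging over the row
    -- weights gives the bound.
    linarith [Real.add_one_le_exp (x j + -r)]
  rw [Finset.sum_add_distrib, ← Finset.sum_mul, ← Finset.sum_mul, h1] at h2
  have h3 := mul_le_mul_of_nonneg_right h (Real.exp_pos (-r)).le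
  rw [← Real.exp_add, add_neg_cancel, Real.exp_zero] at h3
  linarith

/-- The diagonal entries of `g^* g` and of its inverse are at most `exp (2 R)`. -/
def DiagBounded {n d : ℕ} (g : SLPow n d) (R : ℝ) : Prop :=
  ∀ k a, ((((g k : Matrix (Fin n) (Fin n) ℂ)ᴴ * (g k : Matrix (Fin n) (Fin n) ℂ)) a a).re ≤
      Real.exp (2 * R)) ∧
    ((((g k : Matrix (Fin n) (Fin n) ℂ)ᴴ * (g k : Matrix (Fin n) (Fin n) ℂ))⁻¹ a a).re ≤
      Real.exp (2 * R))

/-- Only diagonal entries of the logarithm matter later. Jensen for the conjugated matrix bounds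
them above, and Jensen for its inverse bounds them below; conjugation by `exp (-D)` accounts for the
shift by `2 D`. -/
theorem exists_log_of_diagBounded {n d : ℕ} (g : SLPow n d) (R : ℝ) (hg : DiagBounded g R)
    (D : Fin d → Fin n → ℝ) (hD : ∀ k, ∑ a, D k a = 0) (k : Fin d) :
    ∃ (U : Matrix (Fin n) (Fin n) ℂ) (x : Fin n → ℝ), U * Uᴴ = 1 ∧
      Matrix.diagonal (fun a => ((Real.exp (-D k a) : ℝ) : ℂ)) *
        ((g k : Matrix (Fin n) (Fin n) ℂ)ᴴ * (g k : Matrix (Fin n) (Fin n) ℂ)) *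
        Matrix.diagonal (fun a => ((Real.exp (-D k a) : ℝ) : ℂ)) =
      U * Matrix.diagonal (fun a => ((Real.exp (x a) : ℝ) : ℂ)) * Uᴴ ∧
      ∑ a, ∑ j, ‖U a j‖ ^ 2 * x j = 0 ∧
      ∀ a, |∑ j, ‖U a j‖ ^ 2 * x j + 2 * D k a| ≤ 2 * R := by
  set G := (g k : Matrix (Fin n) (Fin n) ℂ) with hG
  set E := Matrix.diagonal (fun a => ((Real.exp (-D k a) : ℝ) : ℂ)) with hE
  have hEH : Eᴴ = E := by
    rw [hE, Matrix.diagonal_conjTranspose]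
    congr 1
    funext a
    exact Complex.conj_ofReal _
  have hEdet : E.det = 1 := by
    rw [hE, Matrix.det_diagonal, ← Complex.ofReal_prod, ← Real.exp_sum, Finset.sum_neg_distrib,
      hD k]
    simp
  obtain ⟨U, x, hU, hx, hx0⟩ := exists_spectral_log (G * E) (by
    rw [Matrix.det_mul, hEdet, hG, (g k).2]; simp)
  have hH : E * (Gᴴ * G) * E = U * Matrix.diagonal (fun a => ((Real.exp (x a) : ℝ) : ℂ)) * Uᴴ := by
    rw [← hx, Matrix.conjTranspose_mul, hEH]
    simp only [Matrix.mul_assoc]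
  refine ⟨U, x, hU, hH, ?_, fun a => ?_⟩
  -- The double sum is the trace of the logarithm: columns of a unitary matrix have norm one.
  · rw [Finset.sum_comm, ← hx0]
    refine Finset.sum_congr rfl fun j _ => ?_
    rw [← Finset.sum_mul]
    have hU' : Uᴴ * Uᴴᴴ = 1 := by
      rw [Matrix.conjTranspose_conjTranspose]; exact mul_eq_one_comm.mp hU
    have := sum_norm_sq_row_eq_one Uᴴ hU' j
    simp only [Matrix.conjTranspose_apply, norm_star] at this
    rw [this, one_mul]
  · have key1 : ∑ j, ‖U a j‖ ^ 2 * x j ≤ 2 * R - 2 * D k a := by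
      refine sum_row_mul_le_of_exp_le U hU x a _ ?_
      have h1 := congrArg (fun M => (M a a).re) hH
      beta_reduce at h1
      rw [conj_diagonal_apply_self, Complex.ofReal_re] at h1
      rw [← h1, hE, Matrix.mul_diagonal, Matrix.diagonal_mul, Complex.re_mul_ofReal,
        Complex.re_ofReal_mul]
      calc Real.exp (-D k a) * ((Gᴴ * G) a a).re * Real.exp (-D k a)
          = Real.exp (-2 * D k a) * ((Gᴴ * G) a a).re := by
            rw [show -2 * D k a = -D k a + -D k a by ring, Real.exp_add]; ring
        _ ≤ Real.exp (-2 * D k a) * Real.exp (2 * R) :=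
            mul_le_mul_of_nonneg_left (hg k a).1 (Real.exp_pos _).le
        _ = Real.exp (2 * R - 2 * D k a) := by rw [← Real.exp_add]; congr 1; ring
    have key2 : ∑ j, ‖U a j‖ ^ 2 * -x j ≤ 2 * R + 2 * D k a := by
      refine sum_row_mul_le_of_exp_le U hU (fun j => -x j) a _ ?_
      have h1 := congrArg (fun M => (M⁻¹ a a).re) hH
      beta_reduce at h1
      have hEinv : E⁻¹ = Matrix.diagonal (fun a => ((Real.exp (D k a) : ℝ) : ℂ)) := by
        refine Matrix.inv_eq_right_inv ?_
        rw [hE, Matrix.diagonal_mul_diagonal]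
        have : (fun a => ((Real.exp (-D k a) : ℝ) : ℂ) * ((Real.exp (D k a) : ℝ) : ℂ)) =
            fun _ => 1 := by
          funext a
          rw [← Complex.ofReal_mul, ← Real.exp_add]
          simp
        rw [this, Matrix.diagonal_one]
      rw [inv_conj_diagonal_exp U hU, conj_diagonal_apply_self, Complex.ofReal_re,
        Matrix.mul_inv_rev, Matrix.mul_inv_rev, hEinv, Matrix.diagonal_mul, Matrix.mul_diagonal,
        Complex.re_ofReal_mul, Complex.re_mul_ofReal] at h1
      rw [← h1]
      calc Real.exp (D k a) * (((Gᴴ * G)⁻¹ a a).re * Real.exp (D k a))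
          = Real.exp (2 * D k a) * ((Gᴴ * G)⁻¹ a a).re := by
            rw [show 2 * D k a = D k a + D k a by ring, Real.exp_add]; ring
        _ ≤ Real.exp (2 * D k a) * Real.exp (2 * R) :=
            mul_le_mul_of_nonneg_left (hg k a).2 (Real.exp_pos _).le
        _ = Real.exp (2 * R + 2 * D k a) := by rw [← Real.exp_add]; congr 1; ring
    simp only [mul_neg, Finset.sum_neg_distrib] at key2
    rw [abs_le]
    constructor <;> linarith

/-! ### Weights, marginals and the gradient bound. -/

/-- The value of the weight `i` at the point `D` of the Lie algebra of the torus. -/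
noncomputable def pairing {n d : ℕ} (D : Fin d → Fin n → ℝ) (i : Fin d → Fin n) : ℝ :=
  ∑ k, D k (i k)

/-- The squared absolute values of the entries of `exp D · w`. -/
noncomputable def mass {m n d : ℕ} (w : TensorTuple m n d) (D : Fin d → Fin n → ℝ) (l : Fin m)
    (i : Fin d → Fin n) : ℝ :=
  ‖w l i‖ ^ 2 * Real.exp (2 * pairing D i)

/-- The `k`-th marginal of a function on positions. -/
noncomputable def marginal {m n d : ℕ} (p : Fin m → (Fin d → Fin n) → ℝ) (k : Fin d)
    (a : Fin n) : ℝ :=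
  ∑ l, ∑ i, if i k = a then p l i else 0

theorem sum_marginal_mul {m n d : ℕ} (p : Fin m → (Fin d → Fin n) → ℝ) (k : Fin d)
    (f : Fin n → ℝ) : ∑ a, marginal p k a * f a = ∑ l, ∑ i, p l i * f (i k) := by
  simp only [marginal, Finset.sum_mul]
  rw [Finset.sum_comm]
  refine Finset.sum_congr rfl fun l _ => ?_
  rw [Finset.sum_comm]
  refine Finset.sum_congr rfl fun i _ => ?_
  simp [ite_mul]

theorem sum_marginal {m n d : ℕ} (p : Fin m → (Fin d → Fin n) → ℝ) (k : Fin d) :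
    ∑ a, marginal p k a = ∑ l, ∑ i, p l i := by
  simpa using sum_marginal_mul p k fun _ => 1

theorem sum_mul_pairing {m n d : ℕ} (p : Fin m → (Fin d → Fin n) → ℝ) (D : Fin d → Fin n → ℝ) :
    ∑ l, ∑ i, p l i * pairing D i = ∑ k, ∑ a, marginal p k a * D k a := by
  simp only [sum_marginal_mul, pairing, Finset.mul_sum]
  rw [Finset.sum_comm]
  simp_rw [Finset.sum_comm (s := (Finset.univ : Finset (Fin d)))]
  rw [Finset.sum_comm]

/-- The inequality `⊗ exp(X_k) ≥ 1 + ∑ X_k` is tested on `v = exp D · w l`, which has the same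
support as `w l` and hence inherits freeness. -/
theorem sum_mass_add_sum_marginal_le {m n d : ℕ} (w : TensorTuple m n d) (hw : IsFree w)
    (D : Fin d → Fin n → ℝ) (g : SLPow n d) (U : Fin d → Matrix (Fin n) (Fin n) ℂ)
    (x : Fin d → Fin n → ℝ) (hU : ∀ k, U k * (U k)ᴴ = 1)
    (hx : ∀ k, Matrix.diagonal (fun a => ((Real.exp (-D k a) : ℝ) : ℂ)) *
        ((g k : Matrix (Fin n) (Fin n) ℂ)ᴴ * (g k : Matrix (Fin n) (Fin n) ℂ)) *
        Matrix.diagonal (fun a => ((Real.exp (-D k a) : ℝ) : ℂ)) =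
      U k * Matrix.diagonal (fun a => ((Real.exp (x k a) : ℝ) : ℂ)) * (U k)ᴴ) :
    ∑ l, ∑ i, mass w D l i +
      ∑ k, ∑ a, marginal (mass w D) k a * ∑ j, ‖U k a j‖ ^ 2 * x k j ≤
      ‖actTuple g w‖ ^ 2 := by
  simp only [sum_marginal_mul]
  rw [Finset.sum_comm (s := (Finset.univ : Finset (Fin d))) (t := (Finset.univ : Finset (Fin m))),
    ← Finset.sum_add_distrib, norm_sq_tuple]
  refine Finset.sum_le_sum fun l _ => ?_
  set v : (Fin d → Fin n) → ℂ := fun i => ((Real.exp (pairing D i) : ℝ) : ℂ) * w l i with hv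
  have hvn : ∀ i, ‖v i‖ ^ 2 = mass w D l i := by
    intro i
    rw [hv, mass, norm_mul, mul_pow, Complex.norm_real, Real.norm_eq_abs, Real.abs_exp,
      ← Real.exp_nat_mul]
    push_cast
    ring
  set E := fun k => Matrix.diagonal (fun a => ((Real.exp (-D k a) : ℝ) : ℂ)) with hE
  have hEH : ∀ k, (E k)ᴴ = E k := by
    intro k
    rw [hE, Matrix.diagonal_conjTranspose]
    congr 1
    funext a
    exact Complex.conj_ofReal _
  have hwv : (fun i => w l i) = tensorProd E *ᵥ v := by
    rw [hE, tensorProd_diagonal]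
    funext i
    rw [Matrix.mulVec_diagonal, hv, ← Complex.ofReal_prod, ← mul_assoc, ← Complex.ofReal_mul,
      ← Real.exp_sum, ← Real.exp_add, pairing, Finset.sum_neg_distrib]
    simp
  have hnorm : ‖act g (w l)‖ ^ 2 = (star v ⬝ᵥ (tensorProd (fun k => U k * Matrix.diagonal
        (fun a => ((Real.exp (x k a) : ℝ) : ℂ)) * (U k)ᴴ) *ᵥ v)).re := by
    rw [norm_sq_act, hwv, Matrix.star_mulVec, ← Matrix.dotProduct_mulVec, Matrix.mulVec_mulVec,
      Matrix.mulVec_mulVec, tensorProd_conjTranspose, tensorProd_mul, tensorProd_mul]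
    simp_rw [← hx, hEH]
    rfl
  have hfree : ∀ i j : Fin d → Fin n, v i ≠ 0 → v j ≠ 0 → ∀ k,
      (∀ k', k' ≠ k → i k' = j k') → i = j := fun i j hi hj k =>
    hw l i j (right_ne_zero_of_mul hi) (right_ne_zero_of_mul hj) k
  have key := sum_add_log_le_dotProduct_tensorProd U hU x v
  have : (actTuple g w) l = act g (w l) := rfl
  rw [this, hnorm]
  refine le_trans (le_of_eq ?_) key
  congr 1
  · exact Finset.sum_congr rfl fun i _ => (hvn i).symm
  · refine Finset.sum_congr rfl fun k _ => ?_
    rw [dotProduct_update_of_free v k (fun i j hi hj => hfree i j hi hj k), Complex.re_sum]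
    refine Finset.sum_congr rfl fun i _ => ?_
    rw [Complex.re_ofReal_mul, conj_diagonal_apply_self, Complex.ofReal_re, hvn]

/-- The gradient bound for the squared norm along an orbit: for a free tuple, the value at `g` is
at least the value at the torus element `exp D` minus the length of the gradient there times
the distance. -/
theorem norm_sq_actTuple_ge {m n d : ℕ} (w : TensorTuple m n d) (hw : IsFree w)
    (D : Fin d → Fin n → ℝ) (hD : ∀ k, ∑ a, D k a = 0) (g : SLPow n d) (R : ℝ)
    (hg : DiagBounded g R) :
    ∑ l, ∑ i, mass w D l i - 2 * ∑ l, ∑ i, mass w D l i * pairing D i -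
      2 * R * ∑ k, ∑ a, |marginal (mass w D) k a - (∑ l, ∑ i, mass w D l i) / n| ≤
      ‖actTuple g w‖ ^ 2 := by
  choose U x hU hx hx0 hL using exists_log_of_diagBounded g R hg D hD
  refine le_trans ?_ (sum_mass_add_sum_marginal_le w hw D g U x hU hx)
  rw [sum_mul_pairing, sub_sub, sub_eq_add_neg]
  refine add_le_add_right ?_ _
  rw [Finset.mul_sum, Finset.mul_sum, ← Finset.sum_add_distrib, ← Finset.sum_neg_distrib]
  refine Finset.sum_le_sum fun k _ => ?_
  set M := (∑ l, ∑ i, mass w D l i) / n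
  set L := fun a => ∑ j, ‖U k a j‖ ^ 2 * x k j with hLdef
  -- Since `L` and `D k` both sum to zero, the marginal can be centred at its mean `M` at no cost;
  -- adding `2 D k` to `L` then leaves a factor bounded by `2R`.
  have e1 : ∑ a, marginal (mass w D) k a * L a = ∑ a, (marginal (mass w D) k a - M) * (L a + 2 * D k a)
      - 2 * ∑ a, marginal (mass w D) k a * D k a := by
    have : ∀ a, (marginal (mass w D) k a - M) * (L a + 2 * D k a) = marginal (mass w D) k a * L a
        + 2 * (marginal (mass w D) k a * D k a) - M * L a - 2 * M * D k a := fun a => by ring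
    simp only [this, Finset.sum_sub_distrib, Finset.sum_add_distrib, ← Finset.mul_sum, hD k]
    rw [show ∑ a, L a = 0 from hx0 k]
    ring
  rw [show (∑ a, marginal (mass w D) k a * ∑ j, ‖U k a j‖ ^ 2 * x k j) =
    ∑ a, marginal (mass w D) k a * L a from rfl, e1]
  have e2 : -(2 * R * ∑ a, |marginal (mass w D) k a - M|) ≤
      ∑ a, (marginal (mass w D) k a - M) * (L a + 2 * D k a) := by
    rw [Finset.mul_sum, ← Finset.sum_neg_distrib]
    refine Finset.sum_le_sum fun a _ => ?_
    refine le_trans ?_ (neg_abs_le _)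
    rw [abs_mul, neg_le_neg_iff, mul_comm]
    exact mul_le_mul_of_nonneg_right (hL k a) (abs_nonneg _)
  linarith

/-! ### Geodesic balls and the gap criterion. -/

/-- Makes the gradient bound available at an arbitrary group element, with a radius depending on it.
The sum of all the absolute values works because `x ≤ exp (2x)`. -/
theorem exists_diagBounded {n d : ℕ} (g : SLPow n d) : ∃ R, 0 ≤ R ∧ DiagBounded g R := by
  set f : Fin d × Fin n → ℝ := fun q =>
    |(((g q.1 : Matrix (Fin n) (Fin n) ℂ)ᴴ * (g q.1 : Matrix (Fin n) (Fin n) ℂ)) q.2 q.2).re| +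
    |(((g q.1 : Matrix (Fin n) (Fin n) ℂ)ᴴ * (g q.1 : Matrix (Fin n) (Fin n) ℂ))⁻¹ q.2 q.2).re|
  have hf : ∀ q, 0 ≤ f q := fun q => by positivity
  refine ⟨∑ q, f q, Finset.sum_nonneg fun q _ => hf q, fun k a => ?_⟩
  have h1 : f (k, a) ≤ ∑ q, f q :=
    Finset.single_le_sum (fun q _ => hf q) (Finset.mem_univ (k, a))
  have h2 : 2 * (∑ q, f q) + 1 ≤ Real.exp (2 * ∑ q, f q) := Real.add_one_le_exp _
  have h3 : f (k, a) = |(((g k : Matrix (Fin n) (Fin n) ℂ)ᴴ *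
    (g k : Matrix (Fin n) (Fin n) ℂ)) a a).re| +
    |(((g k : Matrix (Fin n) (Fin n) ℂ)ᴴ * (g k : Matrix (Fin n) (Fin n) ℂ))⁻¹ a a).re| := rfl
  have h4 := hf (k, a)
  have h5 := abs_nonneg (((g k : Matrix (Fin n) (Fin n) ℂ)ᴴ *
    (g k : Matrix (Fin n) (Fin n) ℂ)) a a).re
  have h6 := abs_nonneg (((g k : Matrix (Fin n) (Fin n) ℂ)ᴴ *
    (g k : Matrix (Fin n) (Fin n) ℂ))⁻¹ a a).re
  refine ⟨(le_abs_self _).trans ?_, (le_abs_self _).trans ?_⟩ <;> linarith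

/-- The unitary part cancels in `g^* g = exp (2A)`, and every eigenvalue of `A k` is at most the
Frobenius norm in absolute value. A diagonal entry is an average of eigenvalues. -/
theorem diagBounded_of_mem_geodesicBall {n d : ℕ} {R : ℝ} {g : SLPow n d}
    (hg : g ∈ geodesicBall n d R) : DiagBounded g R := by
  obtain ⟨V, A, hV, hA, hAR, hgk⟩ := hg
  intro k a
  set W : Matrix (Fin n) (Fin n) ℂ := (hA k).eigenvectorUnitary.1 with hW
  set θ := (hA k).eigenvalues with hθ
  have hWW : W * Wᴴ = 1 := Unitary.coe_mul_star_self _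
  have hWW' : Wᴴ * W = 1 := mul_eq_one_comm.mp hWW
  have hWu : IsUnit W := .of_mul_eq_one _ hWW
  have hspec : A k = W * Matrix.diagonal (fun j => (θ j : ℂ)) * Wᴴ := by
    have := (hA k).spectral_theorem
    rw [Unitary.conjStarAlgAut_apply] at this
    exact this
  have hWinv : W⁻¹ = Wᴴ := Matrix.inv_eq_right_inv hWW
  have hexp : NormedSpace.exp (A k) =
      W * Matrix.diagonal (fun j => ((Real.exp (θ j) : ℝ) : ℂ)) * Wᴴ := by
    rw [hspec, ← hWinv, Matrix.exp_conj _ _ hWu, Matrix.exp_diagonal]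
    congr 3
    funext j
    rw [Pi.coe_exp, ← Complex.exp_eq_exp_ℂ, Complex.ofReal_exp]
  have hP : (g k : Matrix (Fin n) (Fin n) ℂ)ᴴ * (g k : Matrix (Fin n) (Fin n) ℂ) =
      W * Matrix.diagonal (fun j => ((Real.exp (2 * θ j) : ℝ) : ℂ)) * Wᴴ := by
    have h1 : (V k)ᴴ * V k = 1 := (Matrix.mem_unitaryGroup_iff').mp (hV k)
    rw [hgk k, Matrix.conjTranspose_mul, ← Matrix.exp_conjTranspose, (hA k).eq, Matrix.mul_assoc,
      ← Matrix.mul_assoc (V k)ᴴ, h1, one_mul, hexp]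
    rw [show W * Matrix.diagonal (fun j => ((Real.exp (θ j) : ℝ) : ℂ)) * Wᴴ *
        (W * Matrix.diagonal (fun j => ((Real.exp (θ j) : ℝ) : ℂ)) * Wᴴ) =
        W * (Matrix.diagonal (fun j => ((Real.exp (θ j) : ℝ) : ℂ)) * (Wᴴ * W) *
        Matrix.diagonal (fun j => ((Real.exp (θ j) : ℝ) : ℂ))) * Wᴴ by
      simp only [Matrix.mul_assoc], hWW', mul_one, Matrix.diagonal_mul_diagonal]
    congr 3
    funext j
    rw [← Complex.ofReal_mul, ← Real.exp_add, two_mul]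
  have hR0 : 0 ≤ R := (Real.sqrt_nonneg _).trans hAR
  have htr : ∑ j, θ j ^ 2 = ∑ i, ∑ j, ‖A k i j‖ ^ 2 := by
    have h1 : A k * (A k)ᴴ = W * Matrix.diagonal (fun j => ((θ j ^ 2 : ℝ) : ℂ)) * Wᴴ := by
      rw [(hA k).eq]
      conv_lhs => rw [hspec]
      rw [show W * Matrix.diagonal (fun j => ((θ j : ℝ) : ℂ)) * Wᴴ *
          (W * Matrix.diagonal (fun j => ((θ j : ℝ) : ℂ)) * Wᴴ) =
          W * (Matrix.diagonal (fun j => ((θ j : ℝ) : ℂ)) * (Wᴴ * W) *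
          Matrix.diagonal (fun j => ((θ j : ℝ) : ℂ))) * Wᴴ by
        simp only [Matrix.mul_assoc], hWW', mul_one, Matrix.diagonal_mul_diagonal]
      congr 3
      funext j
      push_cast
      ring
    have h2 := congrArg Matrix.trace h1
    rw [Matrix.trace_mul_cycle, hWW', one_mul, Matrix.trace_diagonal, ← Complex.ofReal_sum] at h2
    have h3 : (A k * (A k)ᴴ).trace = ((∑ i, ∑ j, ‖A k i j‖ ^ 2 : ℝ) : ℂ) := by
      simp only [Matrix.trace, Matrix.diag_apply, Matrix.mul_apply, Matrix.conjTranspose_apply]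
      push_cast
      refine Finset.sum_congr rfl fun i _ => Finset.sum_congr rfl fun j _ => ?_
      rw [← Complex.mul_conj', RCLike.star_def]
    rw [h3] at h2
    exact (Complex.ofReal_injective h2).symm
  have hθR : ∀ j, |θ j| ≤ R := by
    intro j
    refine abs_le_of_sq_le_sq ?_ hR0
    have h1 : θ j ^ 2 ≤ ∑ j, θ j ^ 2 :=
      Finset.single_le_sum (f := fun j => θ j ^ 2) (fun _ _ => sq_nonneg _) (Finset.mem_univ j)
    have h2 : ∑ i, ∑ j, ‖A k i j‖ ^ 2 ≤ ∑ k, ∑ i, ∑ j, ‖A k i j‖ ^ 2 :=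
      Finset.single_le_sum (f := fun k => ∑ i, ∑ j, ‖A k i j‖ ^ 2)
        (fun _ _ => by positivity) (Finset.mem_univ k)
    have h3 := (Real.sqrt_le_left hR0).mp hAR
    linarith
  have key : ∀ y : Fin n → ℝ, (∀ j, y j ≤ 2 * R) →
      ∑ j, ‖W a j‖ ^ 2 * Real.exp (y j) ≤ Real.exp (2 * R) := by
    intro y hy
    calc ∑ j, ‖W a j‖ ^ 2 * Real.exp (y j) ≤ ∑ j, ‖W a j‖ ^ 2 * Real.exp (2 * R) :=
          Finset.sum_le_sum fun j _ =>
            mul_le_mul_of_nonneg_left (Real.exp_le_exp.mpr (hy j)) (sq_nonneg _)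
      _ = Real.exp (2 * R) := by rw [← Finset.sum_mul, sum_norm_sq_row_eq_one W hWW, one_mul]
  rw [hP, inv_conj_diagonal_exp W hWW, conj_diagonal_apply_self, conj_diagonal_apply_self,
    Complex.ofReal_re, Complex.ofReal_re]
  exact ⟨key _ fun j => by linarith [(abs_le.mp (hθR j)).2],
    key _ fun j => by linarith [(abs_le.mp (hθR j)).1]⟩

theorem one_mem_geodesicBall {n d : ℕ} {R : ℝ} (hR : 0 ≤ R) :
    (1 : SLPow n d) ∈ geodesicBall n d R :=
  ⟨fun _ => 1, fun _ => 0, fun _ => one_mem _, fun _ => Matrix.isHermitian_zero,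
    by simpa [frobeniusNorm] using hR, fun _ => by simp⟩

theorem capacity_le {m n d : ℕ} (w : TensorTuple m n d) (g : SLPow n d) :
    capacity w ≤ ‖actTuple g w‖ ^ 2 :=
  ciInf_le ⟨0, by rintro _ ⟨g, rfl⟩; positivity⟩ g

/-- The torus element `exp D`. -/
noncomputable def torusElement {n d : ℕ} (D : Fin d → Fin n → ℝ) (hD : ∀ k, ∑ a, D k a = 0) :
    SLPow n d := fun k =>
  ⟨Matrix.diagonal fun a => ((Real.exp (D k a) : ℝ) : ℂ), by
    rw [Matrix.det_diagonal, ← Complex.ofReal_prod, ← Real.exp_sum, hD k]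
    simp⟩

theorem norm_sq_actTuple_torusElement {m n d : ℕ} (w : TensorTuple m n d)
    (D : Fin d → Fin n → ℝ) (hD : ∀ k, ∑ a, D k a = 0) :
    ‖actTuple (torusElement D hD) w‖ ^ 2 = ∑ l, ∑ i, mass w D l i := by
  rw [norm_sq_tuple]
  refine Finset.sum_congr rfl fun l _ => ?_
  rw [EuclideanSpace.norm_sq_eq]
  refine Finset.sum_congr rfl fun i _ => ?_
  have h1 : actTuple (torusElement D hD) w l i =
      ((Real.exp (pairing D i) : ℝ) : ℂ) * w l i := by
    have h2 : tensorMatrix (torusElement D hD) =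
        tensorProd fun k => Matrix.diagonal fun a => ((Real.exp (D k a) : ℝ) : ℂ) := rfl
    have h3 : actTuple (torusElement D hD) w l i =
      (tensorMatrix (torusElement D hD) *ᵥ fun i => w l i) i := rfl
    rw [h3, h2, tensorProd_diagonal, Matrix.mulVec_diagonal, ← Complex.ofReal_prod, ← Real.exp_sum,
      pairing]
  rw [h1, mass, norm_mul, mul_pow, Complex.norm_real, Real.norm_eq_abs, Real.abs_exp,
    ← Real.exp_nat_mul]
  push_cast
  ring

theorem capacity_le_norm_sq {m n d : ℕ} (w : TensorTuple m n d) : capacity w ≤ ‖w‖ ^ 2 := by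
  refine (capacity_le w (torusElement (fun _ _ => 0) fun _ => by simp)).trans (le_of_eq ?_)
  rw [norm_sq_actTuple_torusElement, norm_sq_tuple]
  refine Finset.sum_congr rfl fun l _ => ?_
  rw [EuclideanSpace.norm_sq_eq]
  simp [mass, pairing]

/-- A free tuple whose weights lie in two parallel hyperplanes, the first of which passes through
the origin, has no points close to its capacity in a ball whose radius is bounded in terms of the
gradient at a torus element. -/
theorem capacity_add_le_iInf_geodesicBall {m n d : ℕ} (w : TensorTuple m n d) (hw : IsFree w)
    (D : Fin d → Fin n → ℝ) (hD : ∀ k, ∑ a, D k a = 0) (h : ℝ) (hh : 0 < h)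
    (hsupp : ∀ l i, w l i ≠ 0 → pairing D i = 0 ∨ pairing D i = -h) (η : ℝ)
    (hη : ∑ l, ∑ i, (if pairing D i = -h then mass w D l i else 0) = η)
    (R : ℝ) (hR0 : 0 ≤ R)
    (hR : R * ∑ k, ∑ a, |marginal (mass w D) k a - (∑ l, ∑ i, mass w D l i) / n| ≤ h * η) :
    capacity w + η ≤ ⨅ g : geodesicBall n d R, ‖actTuple (g : SLPow n d) w‖ ^ 2 := by
  -- A real infimum over an empty index set would be `0`; this is where `0 ≤ R` is used.
  have : Nonempty (geodesicBall n d R) := ⟨⟨1, one_mem_geodesicBall hR0⟩⟩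
  set N := ∑ l, ∑ i, (if pairing D i = 0 then ‖w l i‖ ^ 2 else 0) with hN
  set B := ∑ l, ∑ i, (if pairing D i = -h then ‖w l i‖ ^ 2 else 0) with hB
  have hmass : ∀ s : ℝ, ∑ l, ∑ i, mass w (fun k a => s * D k a) l i =
      N + B * Real.exp (-(2 * h * s)) := by
    intro s
    rw [hN, hB, Finset.sum_mul, ← Finset.sum_add_distrib]
    refine Finset.sum_congr rfl fun l _ => ?_
    rw [Finset.sum_mul, ← Finset.sum_add_distrib]
    refine Finset.sum_congr rfl fun i _ => ?_
    have hp : pairing (fun k a => s * D k a) i = s * pairing D i := by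
      simp [pairing, Finset.mul_sum]
    rw [mass, hp]
    by_cases hwi : w l i = 0
    · simp [hwi]
    · rcases hsupp l i hwi with h0 | h1
      · simp [h0, hh.ne']
      · rw [h1, if_neg (by linarith), if_pos rfl, zero_add]
        congr 2
        ring
  have hηB : B * Real.exp (-(2 * h)) = η := by
    rw [← hη, hB, Finset.sum_mul]
    refine Finset.sum_congr rfl fun l _ => ?_
    rw [Finset.sum_mul]
    refine Finset.sum_congr rfl fun i _ => ?_
    rw [mass]
    split_ifs with h1
    · rw [h1]; congr 2; ring
    · simp
  have hM : ∑ l, ∑ i, mass w D l i = N + η := by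
    have := hmass 1
    simp only [one_mul, mul_one] at this
    rw [this, hηB]
  have hpair : ∑ l, ∑ i, mass w D l i * pairing D i = -h * η := by
    rw [← hη, Finset.mul_sum]
    refine Finset.sum_congr rfl fun l _ => ?_
    rw [Finset.mul_sum]
    refine Finset.sum_congr rfl fun i _ => ?_
    by_cases hwi : w l i = 0
    · simp [mass, hwi]
    · rcases hsupp l i hwi with h0 | h1
      · simp [h0, hh.ne']
      · rw [h1, if_pos rfl]; ring
  -- Along `s D` with `s → ∞` the mass on the second hyperplane vanishes and only `N` remains.
  have hcap : capacity w ≤ N := by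
    have hlim : Filter.Tendsto (fun s : ℝ => N + B * Real.exp (-(2 * h * s))) Filter.atTop
        (nhds (N + B * 0)) := by
      refine Filter.Tendsto.const_add _ (Filter.Tendsto.const_mul _ ?_)
      exact Real.tendsto_exp_neg_atTop_nhds_zero.comp
        (Filter.Tendsto.const_mul_atTop (by positivity) Filter.tendsto_id)
    rw [mul_zero, add_zero] at hlim
    refine ge_of_tendsto' hlim fun s => ?_
    have hs : ∀ k, ∑ a, s * D k a = 0 := fun k => by rw [← Finset.mul_sum, hD k, mul_zero]
    rw [← hmass, ← norm_sq_actTuple_torusElement w _ hs]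
    exact capacity_le w _
  refine le_ciInf fun g => ?_
  -- The pairing term equals `+2 h η`, which pays for the gradient term and leaves `N + η`.
  have := norm_sq_actTuple_ge w hw D hD g R (diagBounded_of_mem_geodesicBall g.2)
  rw [hpair, hM] at this
  rw [hM] at hR
  linarith

/-! ### Lower bounds for the capacity by minimization over the torus. -/

/-- Subtracting the means from `D` turns the problem on trace-zero tuples into an unconstrained one;
the `1 / n` in the derivative is the effect of this projection. -/
theorem hasDerivAt_regularized {m n d : ℕ} (w : TensorTuple m n d) (κ : ℝ)
    (D : Fin d → Fin n → ℝ) (k : Fin d) (a : Fin n) :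
    HasDerivAt (fun s : ℝ => ∑ l, ∑ i, ‖w l i‖ ^ 2 * Real.exp (2 * (pairing D i -
        (∑ k, ∑ a, D k a) / n) + 2 * (((if i k = a then 1 else 0) - 1 / n) * s)) +
        κ * (∑ k, ∑ a, D k a ^ 2 + 2 * D k a * s + s ^ 2))
      (∑ l, ∑ i, ‖w l i‖ ^ 2 * (Real.exp (2 * (pairing D i - (∑ k, ∑ a, D k a) / n)) *
        (2 * ((if i k = a then 1 else 0) - 1 / n))) + κ * (2 * D k a)) 0 := by
  refine HasDerivAt.add (HasDerivAt.fun_sum fun l _ => HasDerivAt.fun_sum fun i _ => ?_) ?_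
  · refine HasDerivAt.const_mul _ ?_
    have h1 : HasDerivAt (fun s : ℝ => 2 * (pairing D i - (∑ k, ∑ a, D k a) / n) +
        2 * (((if i k = a then 1 else 0) - 1 / n) * s))
        (2 * ((if i k = a then 1 else 0) - 1 / n)) 0 := by
      simpa using (((hasDerivAt_id (0 : ℝ)).const_mul
        ((if i k = a then (1 : ℝ) else 0) - 1 / n)).const_mul 2).const_add
        (2 * (pairing D i - (∑ k, ∑ a, D k a) / n))
    have h2 := h1.exp
    rw [mul_zero, mul_zero, add_zero] at h2
    exact h2
  · refine HasDerivAt.const_mul _ ?_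
    have h1 : HasDerivAt (fun s : ℝ => ∑ k, ∑ a, D k a ^ 2 + 2 * D k a * s + s ^ 2)
        (2 * D k a * 1 + ((2 : ℕ) : ℝ) * 0 ^ (2 - 1)) 0 :=
      (((hasDerivAt_id (0 : ℝ)).const_mul (2 * D k a)).const_add
        (∑ k, ∑ a, D k a ^ 2)).add (hasDerivAt_pow 2 (0 : ℝ))
    simpa using h1

/-- The norm need not attain its infimum on the torus orbit; the quadratic term makes the function
coercive. -/
theorem exists_regularized_minimizer {m n d : ℕ} (w : TensorTuple m n d) (κ : ℝ) (hκ : 0 < κ) :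
    ∃ D : Fin d → Fin n → ℝ,
      (∀ D', ∑ l, ∑ i, ‖w l i‖ ^ 2 * Real.exp (2 * (pairing D i - (∑ k, ∑ a, D k a) / n)) +
          κ * ∑ k, ∑ a, D k a ^ 2 ≤
        ∑ l, ∑ i, ‖w l i‖ ^ 2 * Real.exp (2 * (pairing D' i - (∑ k, ∑ a, D' k a) / n)) +
          κ * ∑ k, ∑ a, D' k a ^ 2) := by
  refine Continuous.exists_forall_le ?_ ?_
  · unfold pairing
    fun_prop
  · have h1 : Filter.Tendsto (fun D : Fin d → Fin n → ℝ => κ * ‖D‖ ^ 2) (Filter.cocompact _)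
        Filter.atTop :=
      ((Filter.tendsto_pow_atTop two_ne_zero).comp
        tendsto_norm_cocompact_atTop).const_mul_atTop hκ
    refine Filter.tendsto_atTop_mono (fun D => ?_) h1
    have h2 : 0 ≤ ∑ l, ∑ i, ‖w l i‖ ^ 2 *
        Real.exp (2 * (pairing D i - (∑ k, ∑ a, D k a) / n)) := by positivity
    have h3 : ‖D‖ ^ 2 ≤ ∑ k, ∑ a, D k a ^ 2 := by
      have h0 : 0 ≤ ∑ k, ∑ a, D k a ^ 2 := by positivity
      rw [← Real.le_sqrt (norm_nonneg _) h0, pi_norm_le_iff_of_nonneg (Real.sqrt_nonneg _)]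
      intro k
      rw [pi_norm_le_iff_of_nonneg (Real.sqrt_nonneg _)]
      intro a
      rw [Real.norm_eq_abs]
      refine Real.abs_le_sqrt ?_
      exact (Finset.single_le_sum (f := fun a => D k a ^ 2) (fun _ _ => sq_nonneg _)
        (Finset.mem_univ a)).trans (Finset.single_le_sum (f := fun k => ∑ a, D k a ^ 2)
        (fun _ _ => by positivity) (Finset.mem_univ k))
    nlinarith

/-- Stationarity of the regularized minimizer gives the gradient as `-κ D`, and comparison with `D =
0` gives the energy bound. Together they make the gradient `O(√κ)`. -/
theorem exists_small_gradient {m n d : ℕ} (w : TensorTuple m n d) (hn : n ≠ 0) (κ : ℝ)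
    (hκ : 0 < κ) :
    ∃ D : Fin d → Fin n → ℝ, (∀ k, ∑ a, D k a = 0) ∧
      (∀ k a, marginal (mass w D) k a - (∑ l, ∑ i, mass w D l i) / n = -(κ * D k a)) ∧
      κ * ∑ k, ∑ a, D k a ^ 2 ≤ ∑ l, ∑ i, ‖w l i‖ ^ 2 := by
  have hn' : (n : ℝ) ≠ 0 := Nat.cast_ne_zero.mpr hn
  obtain ⟨D, hmin⟩ := exists_regularized_minimizer w κ hκ
  set p : Fin m → (Fin d → Fin n) → ℝ := fun l i =>
    ‖w l i‖ ^ 2 * Real.exp (2 * (pairing D i - (∑ k, ∑ a, D k a) / n)) with hp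
  have hgrad : ∀ k a, marginal p k a - (∑ l, ∑ i, p l i) / n = -(κ * D k a) := by
    intro k a
    have hd := hasDerivAt_regularized w κ D k a
    have h0 := IsLocalMin.hasDerivAt_eq_zero (Filter.Eventually.of_forall fun s => ?_) hd
    · have h1 : ∑ l, ∑ i, ‖w l i‖ ^ 2 * (Real.exp (2 * (pairing D i - (∑ k, ∑ a, D k a) / n)) *
          (2 * ((if i k = a then 1 else 0) - 1 / n))) =
          2 * (marginal p k a - (∑ l, ∑ i, p l i) / n) := by
        have : ∀ l i, ‖w l i‖ ^ 2 * (Real.exp (2 * (pairing D i - (∑ k, ∑ a, D k a) / n)) *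
            (2 * ((if i k = a then 1 else 0) - 1 / n))) =
            2 * (if i k = a then p l i else 0) - 2 / n * p l i := by
          intro l i
          rw [hp]
          split_ifs <;> ring
        simp only [this, Finset.sum_sub_distrib, ← Finset.mul_sum, marginal]
        ring
      rw [h1] at h0
      linarith
    · have h1 := hmin (fun k' a' => D k' a' + (if k' = k then if a' = a then s else 0 else 0))
      have e1 : ∑ k', ∑ a', (D k' a' + (if k' = k then if a' = a then s else 0 else 0)) =
          ∑ k, ∑ a, D k a + s := by
        simp [Finset.sum_add_distrib]
      have e2 : ∑ k', ∑ a', (D k' a' + (if k' = k then if a' = a then s else 0 else 0)) ^ 2 =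
          ∑ k, ∑ a, D k a ^ 2 + 2 * D k a * s + s ^ 2 := by
        have : ∀ k' a', (D k' a' + (if k' = k then if a' = a then s else 0 else 0)) ^ 2 =
            D k' a' ^ 2 + (if k' = k then if a' = a then 2 * D k a * s + s ^ 2 else 0 else 0) := by
          intro k' a'
          split_ifs with h h'
          · subst h h'; ring
          · ring
          · ring
        simp only [this, Finset.sum_add_distrib]
        simp [add_assoc]
      have e3 : ∀ i, pairing (fun k' a' => D k' a' +
          (if k' = k then if a' = a then s else 0 else 0)) i =
          pairing D i + (if i k = a then s else 0) := by
        intro i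
        simp [pairing, Finset.sum_add_distrib]
      rw [e1, e2] at h1
      simp only [e3] at h1
      simp only [mul_zero, add_zero]
      refine le_trans (le_trans (le_of_eq ?_) h1) (le_of_eq ?_)
      · simp
      · congr 1
        refine Finset.sum_congr rfl fun l _ => Finset.sum_congr rfl fun i _ => ?_
        congr 2
        split_ifs
        · ring
        · ring
  -- Centred marginals sum to zero over `a`, so the stationarity equation forces trace zero.
  have hDsum : ∀ k, ∑ a, D k a = 0 := by
    intro k
    have h1 : ∑ a, (marginal p k a - (∑ l, ∑ i, p l i) / n) = 0 := by
      rw [Finset.sum_sub_distrib, sum_marginal]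
      simp only [Finset.sum_const, Finset.card_univ, Fintype.card_fin, nsmul_eq_mul]
      field_simp
      ring
    simp only [hgrad, Finset.sum_neg_distrib, ← Finset.mul_sum] at h1
    have := neg_eq_zero.mp h1
    exact (mul_eq_zero.mp this).resolve_left hκ.ne'
  have hpm : p = mass w D := by
    funext l i
    simp [hp, mass, hDsum]
  rw [hpm] at hgrad
  refine ⟨D, hDsum, hgrad, ?_⟩
  have h1 := hmin 0
  have h2 : 0 ≤ ∑ l, ∑ i, p l i := by positivity
  simp only [pairing, Pi.zero_apply, Finset.sum_const_zero, zero_div, sub_zero, mul_zero,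
    Real.exp_zero, mul_one, ne_eq, OfNat.ofNat_ne_zero, not_false_eq_true, zero_pow,
    add_zero] at h1
  exact (le_add_of_nonneg_left h2).trans h1

/-- For a free tuple the infimum of the squared norm over the torus bounds the squared norm on the
whole orbit. -/
theorem le_norm_sq_actTuple_of_torus {m n d : ℕ} (w : TensorTuple m n d) (hw : IsFree w)
    (hn : n ≠ 0) (c : ℝ)
    (hc : ∀ D : Fin d → Fin n → ℝ, (∀ k, ∑ a, D k a = 0) → c ≤ ∑ l, ∑ i, mass w D l i)
    (g : SLPow n d) : c ≤ ‖actTuple g w‖ ^ 2 := by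
  obtain ⟨R, hR0, hR⟩ := exists_diagBounded g
  set F := ∑ l, ∑ i, ‖w l i‖ ^ 2 with hF
  have hF0 : 0 ≤ F := by positivity
  have key : ∀ κ : ℝ, 0 < κ → c ≤ ‖actTuple g w‖ ^ 2 + 2 * R * (d * (n * Real.sqrt (κ * F))) := by
    intro κ hκ
    -- At this point the pairing term is `-κ ∑ D² ≤ 0` and each gradient entry is at most `√(κ F)`;
    -- both are harmless as `κ → 0` with `g`, and so `R`, fixed.
    obtain ⟨D, hD, hgrad, hDF⟩ := exists_small_gradient w hn κ hκ
    have h1 := norm_sq_actTuple_ge w hw D hD g R hR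
    have h2 : ∑ l, ∑ i, mass w D l i * pairing D i ≤ 0 := by
      have e : ∀ k a, marginal (mass w D) k a * D k a =
          (∑ l, ∑ i, mass w D l i) / n * D k a - κ * D k a ^ 2 := by
        intro k a
        rw [sub_eq_iff_eq_add.mp (hgrad k a)]
        ring
      rw [sum_mul_pairing]
      simp only [e, Finset.sum_sub_distrib, ← Finset.mul_sum, hD]
      have : 0 ≤ κ * ∑ k, ∑ a, D k a ^ 2 := by positivity
      simpa using this
    have h3 : ∑ k, ∑ a, |marginal (mass w D) k a - (∑ l, ∑ i, mass w D l i) / n| ≤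
        d * (n * Real.sqrt (κ * F)) := by
      have : ∀ k a, |marginal (mass w D) k a - (∑ l, ∑ i, mass w D l i) / n| ≤
          Real.sqrt (κ * F) := by
        intro k a
        rw [hgrad, abs_neg]
        refine Real.abs_le_sqrt ?_
        have : D k a ^ 2 ≤ ∑ k, ∑ a, D k a ^ 2 :=
          (Finset.single_le_sum (f := fun a => D k a ^ 2) (fun _ _ => sq_nonneg _)
          (Finset.mem_univ a)).trans (Finset.single_le_sum (f := fun k => ∑ a, D k a ^ 2)
          (fun _ _ => by positivity) (Finset.mem_univ k))
        have h4 : κ * D k a ^ 2 ≤ F := (mul_le_mul_of_nonneg_left this hκ.le).trans hDF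
        calc (κ * D k a) ^ 2 = κ * (κ * D k a ^ 2) := by ring
          _ ≤ κ * F := mul_le_mul_of_nonneg_left h4 hκ.le
      calc ∑ k, ∑ a, |marginal (mass w D) k a - (∑ l, ∑ i, mass w D l i) / n| ≤
          ∑ k : Fin d, ∑ a : Fin n, Real.sqrt (κ * F) :=
            Finset.sum_le_sum fun k _ => Finset.sum_le_sum fun a _ => this k a
        _ = d * (n * Real.sqrt (κ * F)) := by simp
    have h4 := mul_le_mul_of_nonneg_left h3 (show 0 ≤ 2 * R by linarith)
    linarith [hc D hD]
  have hlim : Filter.Tendsto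
      (fun κ : ℝ => ‖actTuple g w‖ ^ 2 + 2 * R * (d * (n * Real.sqrt (κ * F))))
      (nhdsWithin 0 (Set.Ioi 0)) (nhds (‖actTuple g w‖ ^ 2)) := by
    have hcont : Continuous
        (fun κ : ℝ => ‖actTuple g w‖ ^ 2 + 2 * R * (d * (n * Real.sqrt (κ * F)))) := by fun_prop
    have := (hcont.tendsto 0).mono_left (nhdsWithin_le_nhds (s := Set.Ioi 0))
    simpa using this
  exact ge_of_tendsto hlim (Filter.eventually_of_mem self_mem_nhdsWithin key)

/-- If a free tuple dominates a nonnegative weight with uniform marginals then its capacity is at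
least the total weight. -/
theorem le_capacity_of_uniform_marginals {m n d : ℕ} (w : TensorTuple m n d) (hw : IsFree w)
    (hn : n ≠ 0) (q : Fin m → (Fin d → Fin n) → ℝ) (hq0 : ∀ l i, 0 ≤ q l i)
    (hq : ∀ l i, q l i ≤ ‖w l i‖ ^ 2) (u : Fin d → ℝ) (hu : ∀ k a, marginal q k a = u k) :
    ∑ l, ∑ i, q l i ≤ capacity w := by
  refine le_ciInf fun g => le_norm_sq_actTuple_of_torus w hw hn _ (fun D hD => ?_) g
  have h1 : ∑ l, ∑ i, q l i * pairing D i = 0 := by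
    rw [sum_mul_pairing]
    simp only [hu, ← Finset.mul_sum, hD, mul_zero, Finset.sum_const_zero]
  -- Uniform marginals annihilate the linear term, so `exp x ≥ 1 + x` is summed without loss.
  calc ∑ l, ∑ i, q l i = ∑ l, ∑ i, q l i * (2 * pairing D i + 1) := by
        have : ∀ l i, q l i * (2 * pairing D i + 1) = 2 * (q l i * pairing D i) + q l i :=
          fun l i => by ring
        simp only [this, Finset.sum_add_distrib, ← Finset.mul_sum, h1, mul_zero, zero_add]
    _ ≤ ∑ l, ∑ i, mass w D l i := by
        refine Finset.sum_le_sum fun l _ => Finset.sum_le_sum fun i _ => ?_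
        calc q l i * (2 * pairing D i + 1) ≤ q l i * Real.exp (2 * pairing D i) :=
              mul_le_mul_of_nonneg_left (Real.add_one_le_exp _) (hq0 l i)
          _ ≤ mass w D l i := mul_le_mul_of_nonneg_right (hq l i) (Real.exp_pos _).le

/-! ### Bit complexity and rounding of square roots. -/

theorem size_le_one_add_two_mul_log {N : ℕ} (hN : 1 ≤ N) :
    (Nat.size N : ℝ) ≤ 1 + 2 * Real.log N := by
  have h0 : 0 < Nat.size N := Nat.size_pos.mpr hN
  obtain ⟨s, hs⟩ := Nat.exists_eq_succ_of_ne_zero h0.ne'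
  have h1 : 2 ^ s ≤ N := Nat.lt_size.mp (by omega)
  have h2 : (2 : ℝ) ^ s ≤ N := by exact_mod_cast h1
  have h3 := Real.log_le_log (by positivity) h2
  rw [Real.log_pow] at h3
  have h4 := Real.log_two_gt_d9
  have h5 : (s : ℝ) * (1 / 2) ≤ s * Real.log 2 :=
    mul_le_mul_of_nonneg_left (by linarith) (Nat.cast_nonneg s)
  rw [hs]
  push_cast
  linarith

/-- The constant 5 is two bits for the zero imaginary part, one sign bit, and one from each of the
two `Nat.size` bounds. -/
theorem bitComplexityLE_div {a N : ℕ} (hN : 1 ≤ N) (ha : a ≤ N) :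
    BitComplexityLE ((((a : ℝ) / N : ℝ)) : ℂ) (5 + 4 * Real.log N) := by
  refine ⟨(a : ℚ) / N, 0, by push_cast; simp, ?_⟩
  have h0 : ratBits 0 = 2 := by simp [ratBits]
  have hnum : Nat.size ((a : ℚ) / N).num.natAbs ≤ Nat.size N := by
    refine Nat.size_le_size ?_
    have h1 : ((a : ℚ) / N).num ∣ a := by
      have := Rat.num_dvd (a : ℤ) (b := (N : ℤ)) (by exact_mod_cast (by omega : N ≠ 0))
      rwa [Rat.divInt_eq_div] at this
    rcases Nat.eq_zero_or_pos a with rfl | hapos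
    · simp
    · have h2 := Int.natAbs_dvd_natAbs.mpr h1
      rw [Int.natAbs_natCast] at h2
      exact (Nat.le_of_dvd hapos h2).trans ha
  have hden : Nat.size ((a : ℚ) / N).den ≤ Nat.size N := by
    refine Nat.size_le_size (Nat.le_of_dvd hN ?_)
    have := Rat.den_dvd (a : ℤ) (N : ℤ)
    rw [Rat.divInt_eq_div, Int.cast_natCast, Int.cast_natCast] at this
    exact Int.natCast_dvd_natCast.mp this
  have h1 : ratBits ((a : ℚ) / N) ≤ 1 + Nat.size N + Nat.size N := by
    unfold ratBits; omega
  have h2 : (ratBits ((a : ℚ) / N) : ℝ) ≤ 1 + Nat.size N + Nat.size N := by exact_mod_cast h1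
  have h3 := size_le_one_add_two_mul_log hN
  rw [h0]
  push_cast
  linarith

/-- The square root of `t`, rounded down to a multiple of `1 / N`. -/
noncomputable def roundSqrt (N : ℕ) (t : ℝ) : ℝ := (⌊N * Real.sqrt t⌋₊ : ℝ) / N

theorem roundSqrt_nonneg (N : ℕ) (t : ℝ) : 0 ≤ roundSqrt N t := by
  unfold roundSqrt; positivity

theorem roundSqrt_zero (N : ℕ) : roundSqrt N 0 = 0 := by simp [roundSqrt]

theorem roundSqrt_le_sqrt {N : ℕ} (hN : 1 ≤ N) (t : ℝ) : roundSqrt N t ≤ Real.sqrt t := by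
  have hN' : (0 : ℝ) < N := by exact_mod_cast hN
  rw [roundSqrt, div_le_iff₀ hN', mul_comm]
  exact Nat.floor_le (by positivity)

theorem roundSqrt_sq_le {N : ℕ} (hN : 1 ≤ N) {t : ℝ} (ht : 0 ≤ t) : roundSqrt N t ^ 2 ≤ t := by
  calc roundSqrt N t ^ 2 ≤ Real.sqrt t ^ 2 :=
        pow_le_pow_left₀ (roundSqrt_nonneg N t) (roundSqrt_le_sqrt hN t) 2
    _ = t := Real.sq_sqrt ht

/-- Factor the difference of squares: the roots differ by at most `1 / N` and their sum is at most
`2`. -/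
theorem le_roundSqrt_sq_add {N : ℕ} (hN : 1 ≤ N) {t : ℝ} (ht : 0 ≤ t) (ht1 : t ≤ 1) :
    t ≤ roundSqrt N t ^ 2 + 2 / N := by
  have hN' : (0 : ℝ) < N := by exact_mod_cast hN
  have h1 : Real.sqrt t ≤ roundSqrt N t + 1 / N := by
    rw [roundSqrt, ← add_div, le_div_iff₀ hN', mul_comm]
    exact (Nat.lt_floor_add_one _).le
  have h2 := roundSqrt_le_sqrt hN t
  have h3 : Real.sqrt t ≤ 1 := Real.sqrt_le_one.mpr ht1
  have h4 := roundSqrt_nonneg N t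
  have h5 : (0 : ℝ) ≤ 1 / N := by positivity
  have h6 : t = Real.sqrt t ^ 2 := (Real.sq_sqrt ht).symm
  have h7 : (2 : ℝ) / N = 2 * (1 / N) := by ring
  rw [h7]
  nlinarith

theorem bitComplexityLE_roundSqrt {N : ℕ} (hN : 1 ≤ N) {t : ℝ} (ht1 : t ≤ 1) :
    BitComplexityLE (roundSqrt N t : ℂ) (5 + 4 * Real.log N) := by
  refine bitComplexityLE_div hN ?_
  refine Nat.floor_le_of_le ?_
  have h3 : Real.sqrt t ≤ 1 := Real.sqrt_le_one.mpr ht1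
  calc (N : ℝ) * Real.sqrt t ≤ N * 1 := mul_le_mul_of_nonneg_left h3 (Nat.cast_nonneg N)
    _ = N := mul_one _

theorem BitComplexityLE.mono {z : ℂ} {b b' : ℝ} (h : BitComplexityLE z b) (hb : b ≤ b') :
    BitComplexityLE z b' := by
  obtain ⟨p, q, hz, hpq⟩ := h
  exact ⟨p, q, hz, hpq.trans hb⟩

/-! ### Lifting tensors of order three to tuples of order `3 + e`. -/

/-- The position `(t, l, …, l)`. -/
def liftPos {n : ℕ} (e : ℕ) (l : Fin n) (t : Fin 3 → Fin n) : Fin (3 + e) → Fin n :=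
  Fin.append t fun _ => l

/-- The first three coordinates of a position. -/
def headPos {n e : ℕ} (i : Fin (3 + e) → Fin n) : Fin 3 → Fin n := fun k => i (Fin.castAdd e k)

theorem headPos_liftPos {n e : ℕ} (l : Fin n) (t : Fin 3 → Fin n) :
    headPos (liftPos e l t) = t := by
  funext k; simp [headPos, liftPos]

theorem liftPos_injective {n e : ℕ} (l : Fin n) : Function.Injective (liftPos e l) :=
  Function.LeftInverse.injective (headPos_liftPos l)

/-- The extension `p (i_1, i_2, i_3) · [i_4 = ⋯ = i_d = l]` of a function of three indices. -/
def liftFun {n : ℕ} {α : Type*} [Zero α] (e : ℕ) (p : (Fin 3 → Fin n) → α) (l : Fin n)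
    (i : Fin (3 + e) → Fin n) : α :=
  if i = liftPos e l (headPos i) then p (headPos i) else 0

theorem liftFun_liftPos {n e : ℕ} {α : Type*} [Zero α] (p : (Fin 3 → Fin n) → α) (l : Fin n)
    (t : Fin 3 → Fin n) : liftFun e p l (liftPos e l t) = p t := by
  simp [liftFun, headPos_liftPos]

theorem exists_of_liftFun_ne_zero {n e : ℕ} {α : Type*} [Zero α] {p : (Fin 3 → Fin n) → α}
    {l : Fin n} {i : Fin (3 + e) → Fin n} (h : liftFun e p l i ≠ 0) :
    ∃ t, i = liftPos e l t ∧ p t ≠ 0 := by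
  unfold liftFun at h
  split_ifs at h with hi
  · exact ⟨headPos i, hi, h⟩
  · exact absurd rfl h

theorem sum_liftFun_mul {n e : ℕ} (p : (Fin 3 → Fin n) → ℝ) (l : Fin n)
    (f : (Fin (3 + e) → Fin n) → ℝ) :
    ∑ i, liftFun e p l i * f i = ∑ t, p t * f (liftPos e l t) := by
  symm
  refine Fintype.sum_of_injective (liftPos e l) (liftPos_injective l) _ _ (fun i hi => ?_)
    fun t => by rw [liftFun_liftPos]
  by_contra h
  obtain ⟨t, rfl, -⟩ := exists_of_liftFun_ne_zero (left_ne_zero_of_mul h)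
  exact hi ⟨t, rfl⟩

theorem sum_sum_liftFun {n e : ℕ} (p : (Fin 3 → Fin n) → ℝ) :
    ∑ l, ∑ i, liftFun e p l i = n * ∑ t, p t := by
  have : ∀ l, ∑ i, liftFun e p l i = ∑ t, p t := fun l => by
    simpa using sum_liftFun_mul (e := e) p l fun _ => 1
  simp [this]

theorem marginal_liftFun_castAdd {n e : ℕ} (p : (Fin 3 → Fin n) → ℝ) (k : Fin 3) (a : Fin n) :
    marginal (liftFun e p) (Fin.castAdd e k) a = n * ∑ t, if t k = a then p t else 0 := by
  have : ∀ l, ∑ i, (if i (Fin.castAdd e k) = a then liftFun e p l i else 0) =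
      ∑ t, if t k = a then p t else 0 := fun l => by
    simpa [liftPos] using
      sum_liftFun_mul (e := e) p l fun i => if i (Fin.castAdd e k) = a then 1 else 0
  simp [marginal, this]

/-- The extra factors have uniform marginals for every `p`, because `l` runs over all indices. They
contribute nothing to the gradient, whatever the order. -/
theorem marginal_liftFun_natAdd {n e : ℕ} (p : (Fin 3 → Fin n) → ℝ) (k : Fin e) (a : Fin n) :
    marginal (liftFun e p) (Fin.natAdd 3 k) a = ∑ t, p t := by
  have : ∀ l, ∑ i, (if i (Fin.natAdd 3 k) = a then liftFun e p l i else 0) =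
      if l = a then ∑ t, p t else 0 := fun l => by
    have := sum_liftFun_mul (e := e) p l fun i => if i (Fin.natAdd 3 k) = a then 1 else 0
    simp only [liftPos, Fin.append_right, mul_ite, mul_one, mul_zero] at this
    rw [this]
    split_ifs <;> simp
  simp [marginal, this]

/-- The tuple `w_l = z ⊗ e_l ⊗ ⋯ ⊗ e_l` for a tensor `z` of order three. -/
noncomputable def liftTuple {n : ℕ} (e : ℕ) (z : (Fin 3 → Fin n) → ℝ) :
    TensorTuple n n (3 + e) :=
  WithLp.toLp 2 fun l => WithLp.toLp 2 (liftFun e (fun t => (z t : ℂ)) l)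

theorem liftTuple_apply {n e : ℕ} (z : (Fin 3 → Fin n) → ℝ) (l : Fin n)
    (i : Fin (3 + e) → Fin n) :
    liftTuple e z l i = liftFun e (fun t => (z t : ℂ)) l i := rfl

theorem exists_of_liftTuple_ne_zero {n e : ℕ} {z : (Fin 3 → Fin n) → ℝ} {l : Fin n}
    {i : Fin (3 + e) → Fin n} (h : liftTuple e z l i ≠ 0) :
    ∃ t, i = liftPos e l t ∧ z t ≠ 0 := by
  rw [liftTuple_apply] at h
  obtain ⟨t, ht, ht0⟩ := exists_of_liftFun_ne_zero h
  exact ⟨t, ht, Complex.ofReal_ne_zero.mp ht0⟩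

theorem norm_sq_liftTuple_apply {n e : ℕ} (z : (Fin 3 → Fin n) → ℝ) (l : Fin n)
    (i : Fin (3 + e) → Fin n) :
    ‖liftTuple e z l i‖ ^ 2 = liftFun e (fun t => z t ^ 2) l i := by
  rw [liftTuple_apply]
  unfold liftFun
  split_ifs <;> simp

/-- For fixed `l` the trailing coordinates are constant, so two positions can differ only in the
head, where freeness of `z` applies. -/
theorem isFree_liftTuple {n e : ℕ} (z : (Fin 3 → Fin n) → ℝ)
    (hz : ∀ s t, z s ≠ 0 → z t ≠ 0 → ∀ k, (∀ k', k' ≠ k → s k' = t k') → s = t) :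
    IsFree (liftTuple e z) := by
  intro l i j hi hj k hk
  obtain ⟨s, rfl, hs⟩ := exists_of_liftTuple_ne_zero hi
  obtain ⟨t, rfl, ht⟩ := exists_of_liftTuple_ne_zero hj
  congr 1
  induction k using Fin.addCases with
  | left k =>
    refine hz s t hs ht k fun k' hk' => ?_
    have := hk (Fin.castAdd e k') fun h => hk' (Fin.castAdd_injective 3 e h)
    simpa [liftPos] using this
  | right k =>
    funext k'
    have := hk (Fin.castAdd e k') (by simp [Fin.ext_iff]; omega)
    simpa [liftPos] using this

/-- Extension of a Lie algebra element by zero. -/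
def liftLie {n : ℕ} (e : ℕ) (D : Fin 3 → Fin n → ℝ) : Fin (3 + e) → Fin n → ℝ :=
  Fin.append D fun _ _ => 0

theorem sum_liftLie {n e : ℕ} (D : Fin 3 → Fin n → ℝ) (hD : ∀ k, ∑ a, D k a = 0)
    (k : Fin (3 + e)) : ∑ a, liftLie e D k a = 0 := by
  induction k using Fin.addCases with
  | left k => simpa [liftLie] using hD k
  | right k => simp [liftLie]

theorem pairing_liftLie_liftPos {n e : ℕ} (D : Fin 3 → Fin n → ℝ) (l : Fin n)
    (t : Fin 3 → Fin n) : pairing (liftLie e D) (liftPos e l t) = pairing D t := by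
  simp [pairing, liftLie, liftPos, Fin.sum_univ_add]

theorem mass_liftTuple {n e : ℕ} (z : (Fin 3 → Fin n) → ℝ) (D : Fin 3 → Fin n → ℝ) :
    mass (liftTuple e z) (liftLie e D) =
      liftFun e fun t => z t ^ 2 * Real.exp (2 * pairing D t) := by
  funext l i
  rw [mass, norm_sq_liftTuple_apply]
  unfold liftFun
  split_ifs with hi
  · rw [hi, pairing_liftLie_liftPos, headPos_liftPos]
  · simp

theorem numNonzero_liftTuple_le {n e : ℕ} (z : (Fin 3 → Fin n) → ℝ) {ι : Type*} [Fintype ι]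
    (f : ι → Fin 3 → Fin n) (hf : ∀ t, z t ≠ 0 → ∃ j, t = f j) :
    numNonzero (liftTuple e z) ≤ n * Fintype.card ι := by
  have hsub : {p : Fin n × (Fin (3 + e) → Fin n) | liftTuple e z p.1 p.2 ≠ 0} ⊆
      (fun q : Fin n × ι => (q.1, liftPos e q.1 (f q.2))) '' Set.univ := by
    rintro ⟨l, i⟩ hi
    have hi' : liftTuple e z l i ≠ 0 := hi
    obtain ⟨t, rfl, ht⟩ := exists_of_liftTuple_ne_zero hi'
    obtain ⟨j, rfl⟩ := hf t ht
    exact ⟨(l, j), trivial, rfl⟩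
  calc numNonzero (liftTuple e z) ≤ _ := Set.ncard_le_ncard hsub (Set.toFinite _)
    _ ≤ (Set.univ : Set (Fin n × ι)).ncard := Set.ncard_image_le (Set.toFinite _)
    _ = n * Fintype.card ι := by rw [Set.ncard_univ]; simp

theorem norm_sq_liftTuple {n e : ℕ} (z : (Fin 3 → Fin n) → ℝ) :
    ‖liftTuple e z‖ ^ 2 = n * ∑ t, z t ^ 2 := by
  rw [norm_sq_tuple, ← sum_sum_liftFun (e := e)]
  refine Finset.sum_congr rfl fun l _ => ?_
  rw [EuclideanSpace.norm_sq_eq]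
  exact Finset.sum_congr rfl fun i _ => norm_sq_liftTuple_apply z l i

theorem capacity_liftTuple_add_le {n e : ℕ} (hn : n ≠ 0) (z : (Fin 3 → Fin n) → ℝ)
    (hz : ∀ s t, z s ≠ 0 → z t ≠ 0 → ∀ k, (∀ k', k' ≠ k → s k' = t k') → s = t)
    (D : Fin 3 → Fin n → ℝ) (hD : ∀ k, ∑ a, D k a = 0) (h : ℝ) (hh : 0 < h)
    (hsupp : ∀ t, z t ≠ 0 → pairing D t = 0 ∨ pairing D t = -h) (η : ℝ)
    (p : (Fin 3 → Fin n) → ℝ) (hp : ∀ t, p t = z t ^ 2 * Real.exp (2 * pairing D t))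
    (hη : ∑ t, (if pairing D t = -h then p t else 0) = η) (R : ℝ) (hR0 : 0 ≤ R)
    (hR : R * ∑ k, ∑ a, |n * (∑ t, if t k = a then p t else 0) - ∑ t, p t| ≤ h * (n * η)) :
    capacity (liftTuple e z) + n * η ≤
      ⨅ g : geodesicBall n (3 + e) R, ‖actTuple (g : SLPow n (3 + e)) (liftTuple e z)‖ ^ 2 := by
  have hm : mass (liftTuple e z) (liftLie e D) = liftFun e p := by
    rw [mass_liftTuple]
    congr 1
    funext t
    rw [hp]
  have hn' : (n : ℝ) ≠ 0 := Nat.cast_ne_zero.mpr hn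
  refine capacity_add_le_iInf_geodesicBall _ (isFree_liftTuple z hz) (liftLie e D)
    (sum_liftLie D hD) h hh ?_ _ ?_ R hR0 ?_
  · intro l i hi
    obtain ⟨t, rfl, ht⟩ := exists_of_liftTuple_ne_zero hi
    rw [pairing_liftLie_liftPos]
    exact hsupp t ht
  · rw [hm, ← hη]
    have : ∀ l, ∑ i, (if pairing (liftLie e D) i = -h then liftFun e p l i else 0) =
        ∑ t, if pairing D t = -h then p t else 0 := fun l => by
      simpa [pairing_liftLie_liftPos] using
        sum_liftFun_mul (e := e) p l fun i => if pairing (liftLie e D) i = -h then 1 else 0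
    simp [this]
  · rw [hm, sum_sum_liftFun, mul_div_cancel_left₀ _ hn', Fin.sum_univ_add]
    simp only [marginal_liftFun_castAdd, marginal_liftFun_natAdd, sub_self, abs_zero,
      Finset.sum_const_zero, add_zero]
    exact hR

theorem le_capacity_liftTuple {n e : ℕ} (hn : n ≠ 0) (z : (Fin 3 → Fin n) → ℝ)
    (hz : ∀ s t, z s ≠ 0 → z t ≠ 0 → ∀ k, (∀ k', k' ≠ k → s k' = t k') → s = t)
    (q : (Fin 3 → Fin n) → ℝ) (hq0 : ∀ t, 0 ≤ q t) (hq : ∀ t, q t ≤ z t ^ 2) (u : ℝ)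
    (hu : ∀ (k : Fin 3) (a : Fin n), ∑ t, (if t k = a then q t else 0) = u) :
    n * ∑ t, q t ≤ capacity (liftTuple e z) := by
  have h1 : ∀ l i, 0 ≤ liftFun e q l i := by
    intro l i
    unfold liftFun
    split_ifs
    exacts [hq0 _, le_rfl]
  have h2 : ∀ l i, liftFun e q l i ≤ ‖liftTuple e z l i‖ ^ 2 := by
    intro l i
    rw [norm_sq_liftTuple_apply]
    unfold liftFun
    split_ifs
    exacts [hq _, le_rfl]
  have := le_capacity_of_uniform_marginals (liftTuple e z) (isFree_liftTuple z hz) hn (liftFun e q)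
    h1 h2 (Fin.append (fun _ => n * u) fun _ => ∑ t, q t) (fun k a => by
      induction k using Fin.addCases with
      | left k => rw [marginal_liftFun_castAdd, hu, Fin.append_left]
      | right k => rw [marginal_liftFun_natAdd, Fin.append_right])
  rwa [sum_sum_liftFun] at this

/-! ### The chain construction. -/

/-- Labels for the orbits, under cyclic shifts, of the positions used in the chain construction on
the index set `{0, …, 3 (m + 1) + r - 1}`. The indices `3 i`, `3 i + 1`, `3 i + 2` carry the values
`2 ^ i`, `-2 ^ i`, `0` of a linear functional, the last `r` indices the value `0`. -/
abbrev Orbit (m r : ℕ) : Type := Fin (m + 1) ⊕ Fin m ⊕ Fin (m + 1) ⊕ Fin r ⊕ Unit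

/-- A representative of an orbit: the triples `(3 i, 3 i + 1, 3 i + 2)`, `(3 i, 3 i, 3 i + 4)`,
`(3 i + 2, 3 i + 2, 3 i + 2)`, the constant triples of the last `r` indices, and the special
triple `(1, 1, 1)`. -/
def orbitVal (m r : ℕ) : Orbit m r → Fin 3 → ℕ
  | .inl i => ![3 * i, 3 * i + 1, 3 * i + 2]
  | .inr (.inl i) => ![3 * i, 3 * i, 3 * i + 4]
  | .inr (.inr (.inl i)) => fun _ => 3 * i + 2
  | .inr (.inr (.inr (.inl j))) => fun _ => 3 * (m + 1) + j
  | .inr (.inr (.inr (.inr _))) => fun _ => 1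

theorem orbitVal_lt {m r : ℕ} (o : Orbit m r) (k : Fin 3) :
    orbitVal m r o k < 3 * (m + 1) + r := by
  rcases o with i | i | i | j | u <;> fin_cases k <;> simp [orbitVal] <;> omega

/-- The position with label `o` shifted by `ρ`. -/
def orbitPos {m r : ℕ} (o : Orbit m r) (ρ : Fin 3) : Fin 3 → Fin (3 * (m + 1) + r) :=
  fun k => ⟨orbitVal m r o (k + ρ), orbitVal_lt o _⟩

-- Two cyclically consecutive entries of a representative determine the third. The residues mod 3
-- and the order of the pair separate the cases; this is the source of freeness.
set_option maxHeartbeats 4000000 in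
theorem orbitVal_eq_of_eq {m r : ℕ} (o o' : Orbit m r) (κ κ' : Fin 3)
    (h1 : orbitVal m r o (κ + 1) = orbitVal m r o' (κ' + 1))
    (h2 : orbitVal m r o (κ + 2) = orbitVal m r o' (κ' + 2)) :
    orbitVal m r o κ = orbitVal m r o' κ' := by
  rcases o with i | i | i | j | u <;> rcases o' with i' | i' | i' | j' | u' <;>
    fin_cases κ <;> fin_cases κ' <;> simp [orbitVal] at h1 h2 ⊢ <;> omega

theorem orbitPos_free {m r : ℕ} (o o' : Orbit m r) (ρ ρ' k : Fin 3)
    (h : ∀ k', k' ≠ k → orbitPos o ρ k' = orbitPos o' ρ' k') :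
    orbitPos o ρ = orbitPos o' ρ' := by
  have hv : ∀ k', k' ≠ k → orbitVal m r o (k' + ρ) = orbitVal m r o' (k' + ρ') := fun k' hk' =>
    Fin.ext_iff.mp (h k' hk')
  have e1 := hv (k + 1) ((by decide : ∀ k : Fin 3, k + 1 ≠ k) k)
  have e2 := hv (k + 2) ((by decide : ∀ k : Fin 3, k + 2 ≠ k) k)
  rw [add_right_comm, add_right_comm k 1] at e1
  rw [add_right_comm, add_right_comm k 2] at e2
  have e0 := orbitVal_eq_of_eq o o' (k + ρ) (k + ρ') e1 e2
  funext k'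
  by_cases hk : k' = k
  · subst hk; exact Fin.ext e0
  · exact h k' hk

/-- The function on positions obtained by placing the weight `wt o` at each cyclic shift of `o`. -/
noncomputable def orbitSum {m r : ℕ} (wt : Orbit m r → ℝ)
    (t : Fin 3 → Fin (3 * (m + 1) + r)) : ℝ :=
  ∑ o, ∑ ρ, if t = orbitPos o ρ then wt o else 0

/-- Including all cyclic shifts makes the three marginals equal, so one computation over
representatives serves every `k`. -/
theorem sum_orbitSum_mul {m r : ℕ} (wt : Orbit m r → ℝ) (F : Fin (3 * (m + 1) + r) → ℝ)
    (k : Fin 3) : ∑ t, orbitSum wt t * F (t k) =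
      ∑ o, wt o * ∑ κ, F ⟨orbitVal m r o κ, orbitVal_lt o κ⟩ := by
  simp only [orbitSum, Finset.sum_mul]
  rw [Finset.sum_comm]
  refine Finset.sum_congr rfl fun o _ => ?_
  rw [Finset.sum_comm, Finset.mul_sum]
  refine Fintype.sum_equiv (Equiv.addLeft k) _ _ fun ρ => ?_
  simp [ite_mul, orbitPos]

theorem orbitSum_ne_zero {m r : ℕ} {wt : Orbit m r → ℝ} {t : Fin 3 → Fin (3 * (m + 1) + r)}
    (h : orbitSum wt t ≠ 0) : ∃ o ρ, t = orbitPos o ρ ∧ wt o ≠ 0 := by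
  obtain ⟨o, -, ho⟩ := Finset.exists_ne_zero_of_sum_ne_zero h
  obtain ⟨ρ, -, hρ⟩ := Finset.exists_ne_zero_of_sum_ne_zero ho
  split_ifs at hρ with ht
  · exact ⟨o, ρ, ht, hρ⟩
  · exact absurd rfl hρ

theorem orbitSum_mono {m r : ℕ} {wt wt' : Orbit m r → ℝ} (h : ∀ o, wt o ≤ wt' o)
    (t : Fin 3 → Fin (3 * (m + 1) + r)) : orbitSum wt t ≤ orbitSum wt' t := by
  refine Finset.sum_le_sum fun o _ => Finset.sum_le_sum fun ρ _ => ?_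
  split_ifs
  exacts [h o, le_rfl]

theorem orbitSum_nonneg {m r : ℕ} {wt : Orbit m r → ℝ} (h : ∀ o, 0 ≤ wt o)
    (t : Fin 3 → Fin (3 * (m + 1) + r)) : 0 ≤ orbitSum wt t := by
  refine Finset.sum_nonneg fun o _ => Finset.sum_nonneg fun ρ _ => ?_
  split_ifs
  exacts [h o, le_rfl]

theorem le_orbitSum {m r : ℕ} {wt : Orbit m r → ℝ} (h : ∀ o, 0 ≤ wt o) (o : Orbit m r)
    (ρ : Fin 3) : wt o ≤ orbitSum wt (orbitPos o ρ) := by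
  have h0 : ∀ o' ρ', 0 ≤ if orbitPos o ρ = orbitPos o' ρ' then wt o' else 0 := by
    intro o' ρ'
    split_ifs
    exacts [h o', le_rfl]
  calc wt o = if orbitPos o ρ = orbitPos o ρ then wt o else 0 := by simp
    _ ≤ ∑ ρ', if orbitPos o ρ = orbitPos o ρ' then wt o else 0 :=
        Finset.single_le_sum (fun ρ' _ => h0 o ρ') (Finset.mem_univ ρ)
    _ ≤ orbitSum wt (orbitPos o ρ) :=
        Finset.single_le_sum (f := fun o' => ∑ ρ', if orbitPos o ρ = orbitPos o' ρ' then wt o' else 0)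
          (fun o' _ => Finset.sum_nonneg fun ρ' _ => h0 o' ρ') (Finset.mem_univ o)

theorem orbitSum_mul_const {m r : ℕ} (wt : Orbit m r → ℝ) (c : ℝ)
    (t : Fin 3 → Fin (3 * (m + 1) + r)) :
    orbitSum (fun o => c * wt o) t = c * orbitSum wt t := by
  simp only [orbitSum, Finset.mul_sum, mul_ite, mul_zero]

theorem sum_range_three_mul (G : ℕ → ℝ) (m : ℕ) :
    ∑ i ∈ Finset.range m, (G (3 * i) + G (3 * i + 1) + G (3 * i + 2)) =
      ∑ a ∈ Finset.range (3 * m), G a := by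
  induction m with
  | zero => simp
  | succ m ih =>
    rw [Finset.sum_range_succ, ih, show 3 * (m + 1) = 3 * m + 1 + 1 + 1 by ring,
      Finset.sum_range_succ, Finset.sum_range_succ, Finset.sum_range_succ]
    ring

/-- The balanced weights with a small excess `η` on the special position. -/
noncomputable def chainWeight (m r : ℕ) (α η : ℝ) : Orbit m r → ℝ
  | .inl i => α - η / 2 ^ (i : ℕ)
  | .inr (.inl i) => η / 2 ^ ((i : ℕ) + 1)
  | .inr (.inr (.inl i)) => η / 2 ^ (i : ℕ) / 3
  | .inr (.inr (.inr (.inl _))) => α / 3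
  | .inr (.inr (.inr (.inr _))) => η / 3

/-- Marginals tested against `G`. Link `i` uses index `3i` twice and `3i + 4` once: its weight `η /
2^(i+1)` restores the deficit `η / 2^i` at `3i` and, with half the weight, the one at `3(i+1) + 1`.
Index `1` is restored by the special position, and only `3m`, which has no outgoing link, stays
short. -/
theorem chainWeight_telescope (G : ℕ → ℝ) (m : ℕ) (α η : ℝ) :
    ∑ i ∈ Finset.range (m + 1), (α - η / 2 ^ i) * (G (3 * i) + G (3 * i + 1) + G (3 * i + 2)) +
      ∑ i ∈ Finset.range m, η / 2 ^ (i + 1) * (2 * G (3 * i) + G (3 * i + 4)) +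
      ∑ i ∈ Finset.range (m + 1), η / 2 ^ i * G (3 * i + 2) + η * G 1 =
    α * ∑ i ∈ Finset.range (m + 1), (G (3 * i) + G (3 * i + 1) + G (3 * i + 2)) -
      η / 2 ^ m * G (3 * m) := by
  induction m with
  | zero => simp; ring
  | succ m ih =>
    have e : 3 * (m + 1) + 1 = 3 * m + 4 := by ring
    have h2 : η / 2 ^ m = 2 * (η / 2 ^ (m + 1)) := by rw [pow_succ]; field_simp
    simp only [Finset.sum_range_succ, e, h2] at ih ⊢
    linear_combination ih

theorem sum_chainWeight_mul {m r : ℕ} (α η : ℝ) (F : Fin (3 * (m + 1) + r) → ℝ) :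
    ∑ o, chainWeight m r α η o * ∑ κ, F ⟨orbitVal m r o κ, orbitVal_lt o κ⟩ =
      α * ∑ a, F a - η / 2 ^ m * F ⟨3 * m, by omega⟩ := by
  set G : ℕ → ℝ := fun a => if h : a < 3 * (m + 1) + r then F ⟨a, h⟩ else 0 with hG
  have hFG : ∀ a (h : a < 3 * (m + 1) + r), F ⟨a, h⟩ = G a := fun a h => by simp [hG, h]
  simp only [hFG, Fintype.sum_sum_type, chainWeight, orbitVal, Fin.sum_univ_three,
    Finset.univ_unique, Finset.sum_singleton]
  have key := chainWeight_telescope G m α η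
  rw [sum_range_three_mul] at key
  rw [Fin.sum_univ_eq_sum_range G, Finset.sum_range_add]
  simp only [Finset.sum_range] at key ⊢
  have e1 : ∀ i : Fin m, η / 2 ^ ((i : ℕ) + 1) * (G (3 * i) + G (3 * i) + G (3 * i + 4)) =
      η / 2 ^ ((i : ℕ) + 1) * (2 * G (3 * i) + G (3 * i + 4)) := fun i => by ring
  have e2 : ∀ i : Fin (m + 1), η / 2 ^ (i : ℕ) / 3 *
      (G (3 * i + 2) + G (3 * i + 2) + G (3 * i + 2)) = η / 2 ^ (i : ℕ) * G (3 * i + 2) :=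
    fun i => by ring
  have e3 : ∀ j : Fin r, α / 3 *
      (G (3 * (m + 1) + j) + G (3 * (m + 1) + j) + G (3 * (m + 1) + j)) =
      α * G (3 * (m + 1) + j) := fun j => by ring
  simp [e1, e2, e3, ← Finset.mul_sum] at key ⊢
  linear_combination key

/-- The functional with values `2 ^ i`, `-2 ^ i`, `0` at `3 i`, `3 i + 1`, `3 i + 2` for `i ≤ m`
and zero elsewhere. -/
noncomputable def chainValue (m : ℕ) (a : ℕ) : ℝ :=
  if a < 3 * (m + 1) then
    if a % 3 = 0 then 2 ^ (a / 3) else if a % 3 = 1 then -2 ^ (a / 3) else 0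
  else 0

theorem chainValue_zero {m i : ℕ} (hi : i < m + 1) : chainValue m (3 * i) = 2 ^ i := by
  rw [chainValue, if_pos (by omega), if_pos (by omega), show 3 * i / 3 = i by omega]

theorem chainValue_one {m i : ℕ} (hi : i < m + 1) : chainValue m (3 * i + 1) = -2 ^ i := by
  rw [chainValue, if_pos (by omega), if_neg (by omega), if_pos (by omega),
    show (3 * i + 1) / 3 = i by omega]

theorem chainValue_two {m i : ℕ} (hi : i < m + 1) : chainValue m (3 * i + 2) = 0 := by
  rw [chainValue, if_pos (by omega), if_neg (by omega), if_neg (by omega)]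

theorem chainValue_tail (m j : ℕ) : chainValue m (3 * (m + 1) + j) = 0 := by
  rw [chainValue, if_neg (by omega)]

theorem sum_chainValue (m r : ℕ) : ∑ a : Fin (3 * (m + 1) + r), chainValue m a = 0 := by
  rw [Fin.sum_univ_eq_sum_range (chainValue m), Finset.sum_range_add, ← sum_range_three_mul]
  have h1 : ∑ i ∈ Finset.range (m + 1), (chainValue m (3 * i) + chainValue m (3 * i + 1) +
      chainValue m (3 * i + 2)) = 0 := by
    refine Finset.sum_eq_zero fun i hi => ?_
    have hi := Finset.mem_range.mp hi
    rw [chainValue_zero hi, chainValue_one hi, chainValue_two hi]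
    ring
  simp [h1, chainValue_tail]

/-- The powers of two are chosen so that the links `2^i + 2^i - 2^(i+1)` vanish. Only `(1, 1, 1)`
leaves the hyperplane. -/
theorem sum_chainValue_orbitVal {m r : ℕ} (o : Orbit m r) :
    ∑ κ, chainValue m (orbitVal m r o κ) = if o = .inr (.inr (.inr (.inr ()))) then -3 else 0 := by
  rcases o with i | i | i | j | u
  · simp [orbitVal, Fin.sum_univ_three, chainValue_zero i.2, chainValue_one i.2,
      chainValue_two i.2]
  · have h1 : (i : ℕ) < m + 1 := by omega
    have h2 : (i : ℕ) + 1 < m + 1 := by omega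
    have h3 := chainValue_one h2
    rw [show 3 * ((i : ℕ) + 1) + 1 = 3 * i + 4 by ring] at h3
    simp [orbitVal, Fin.sum_univ_three, chainValue_zero h1, h3]
    ring
  · simp [orbitVal, chainValue_two i.2]
  · simp [orbitVal, chainValue_tail]
  · have := chainValue_one (m := m) (i := 0) (by omega)
    simp only [mul_zero, zero_add, pow_zero] at this
    simp [orbitVal, this]

/-- The direction along which the special position decays. -/
noncomputable def chainLie (m r : ℕ) (h : ℝ) : Fin 3 → Fin (3 * (m + 1) + r) → ℝ :=
  fun _ a => h / 3 * chainValue m a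

theorem sum_chainLie (m r : ℕ) (h : ℝ) (k : Fin 3) : ∑ a, chainLie m r h k a = 0 := by
  simp only [chainLie, ← Finset.mul_sum, sum_chainValue, mul_zero]

theorem pairing_chainLie {m r : ℕ} (h : ℝ) (o : Orbit m r) (ρ : Fin 3) :
    pairing (chainLie m r h) (orbitPos o ρ) =
      if o = .inr (.inr (.inr (.inr ()))) then -h else 0 := by
  have h1 : ∑ k, chainValue m (orbitVal m r o (k + ρ)) =
      ∑ κ, chainValue m (orbitVal m r o κ) :=
    Fintype.sum_equiv (Equiv.addRight ρ) _ _ fun k => rfl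
  simp only [pairing, chainLie, orbitPos, ← Finset.mul_sum]
  rw [h1, sum_chainValue_orbitVal]
  split_ifs <;> ring

/-- The label of the special position `(1, 1, 1)`. -/
abbrev specialOrbit (m r : ℕ) : Orbit m r := .inr (.inr (.inr (.inr ())))

theorem orbitPos_special {m r : ℕ} (ρ : Fin 3) :
    orbitPos (specialOrbit m r) ρ = orbitPos (specialOrbit m r) 0 := rfl

theorem orbitPos_eq_special_iff {m r : ℕ} (o : Orbit m r) (ρ : Fin 3) :
    orbitPos o ρ = orbitPos (specialOrbit m r) 0 ↔ o = specialOrbit m r := by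
  constructor
  · intro h
    have h1 := pairing_chainLie 1 o ρ
    rw [h, pairing_chainLie, if_pos rfl] at h1
    by_contra ho
    rw [if_neg ho] at h1
    norm_num at h1
  · rintro rfl
    exact orbitPos_special ρ

/-- The three shifts of a constant triple coincide, which is why constant triples carry a third of
their weight in `chainWeight`. -/
theorem orbitSum_special {m r : ℕ} (α η : ℝ) :
    orbitSum (chainWeight m r α η) (orbitPos (specialOrbit m r) 0) = η := by
  rw [orbitSum, Finset.sum_eq_single (specialOrbit m r)]
  · simp only [orbitPos_special, if_true, Finset.sum_const, Finset.card_univ, Fintype.card_fin,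
      chainWeight]
    simp
    ring
  · intro o _ ho
    refine Finset.sum_eq_zero fun ρ _ => ?_
    rw [if_neg fun h => ho ((orbitPos_eq_special_iff o ρ).mp h.symm)]
  · simp

/-- The tensor of order three with squared entries close to the balanced weights, except at the
special position, where it is close to `α`. -/
noncomputable def chainTensor (m r N : ℕ) (α η : ℝ) (t : Fin 3 → Fin (3 * (m + 1) + r)) : ℝ :=
  if t = orbitPos (specialOrbit m r) 0 then roundSqrt N α
  else roundSqrt N (orbitSum (chainWeight m r α η) t)

theorem exists_of_chainTensor_ne_zero {m r N : ℕ} {α η : ℝ}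
    {t : Fin 3 → Fin (3 * (m + 1) + r)} (h : chainTensor m r N α η t ≠ 0) :
    ∃ q : Orbit m r × Fin 3, t = orbitPos q.1 q.2 := by
  unfold chainTensor at h
  split_ifs at h with ht
  · exact ⟨(specialOrbit m r, 0), ht⟩
  · have : orbitSum (chainWeight m r α η) t ≠ 0 := fun h0 => h (by rw [h0, roundSqrt_zero])
    obtain ⟨o, ρ, ho, -⟩ := orbitSum_ne_zero this
    exact ⟨(o, ρ), ho⟩

theorem chainTensor_free {m r N : ℕ} {α η : ℝ} (s t : Fin 3 → Fin (3 * (m + 1) + r))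
    (hs : chainTensor m r N α η s ≠ 0) (ht : chainTensor m r N α η t ≠ 0) (k : Fin 3)
    (h : ∀ k', k' ≠ k → s k' = t k') : s = t := by
  obtain ⟨⟨o, ρ⟩, rfl⟩ := exists_of_chainTensor_ne_zero hs
  obtain ⟨⟨o', ρ'⟩, rfl⟩ := exists_of_chainTensor_ne_zero ht
  exact orbitPos_free o o' ρ ρ' k h

theorem pairing_chainLie_of_ne_zero {m r N : ℕ} {α η : ℝ} (h : ℝ)
    (t : Fin 3 → Fin (3 * (m + 1) + r)) (ht : chainTensor m r N α η t ≠ 0) :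
    pairing (chainLie m r h) t = if t = orbitPos (specialOrbit m r) 0 then -h else 0 := by
  obtain ⟨⟨o, ρ⟩, rfl⟩ := exists_of_chainTensor_ne_zero ht
  simp only [pairing_chainLie, orbitPos_eq_special_iff]

/-- There are exactly as many orbit labels as indices, with three shifts each. -/
theorem numNonzero_chainTensor_le (m r N e : ℕ) (α η : ℝ) :
    numNonzero (liftTuple e (chainTensor m r N α η)) ≤
      (3 * (m + 1) + r) * (3 * (3 * (m + 1) + r)) := by
  refine (numNonzero_liftTuple_le _ (fun q : Orbit m r × Fin 3 => orbitPos q.1 q.2)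
    fun t ht => exists_of_chainTensor_ne_zero ht).trans (le_of_eq ?_)
  congr 1
  simp
  ring

theorem sum_orbitSum_chainWeight {m r : ℕ} (α η : ℝ) :
    ∑ t, orbitSum (chainWeight m r α η) t =
      α * ((3 * (m + 1) + r : ℕ) : ℝ) - η / 2 ^ m := by
  have := (sum_orbitSum_mul (chainWeight m r α η) (fun _ => 1) 0).trans
    (sum_chainWeight_mul α η fun _ => 1)
  simpa using this

theorem marginal_orbitSum_chainWeight {m r : ℕ} (α η : ℝ) (k : Fin 3)
    (a : Fin (3 * (m + 1) + r)) :
    ∑ t, (if t k = a then orbitSum (chainWeight m r α η) t else 0) =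
      α - if a = ⟨3 * m, by omega⟩ then η / 2 ^ m else 0 := by
  have := (sum_orbitSum_mul (chainWeight m r α η) (fun b => if b = a then 1 else 0) k).trans
    (sum_chainWeight_mul α η fun b => if b = a then 1 else 0)
  simp only [mul_ite, mul_one, mul_zero, Finset.sum_ite_eq', Finset.mem_univ, if_true] at this
  rw [this]
  simp only [eq_comm]

theorem chainWeight_nonneg {m r : ℕ} {α η : ℝ} (hη : 0 ≤ η) (hηα : η ≤ α) (o : Orbit m r) :
    0 ≤ chainWeight m r α η o := by
  rcases o with i | i | i | j | u <;> simp only [chainWeight]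
  · have : η / 2 ^ (i : ℕ) ≤ η := div_le_self hη (one_le_pow₀ (by norm_num))
    linarith
  · positivity
  · positivity
  · linarith
  · linarith

/-- The balanced weights without the small excess, halved. -/
noncomputable def uniformWeight (m r : ℕ) (α : ℝ) : Orbit m r → ℝ :=
  fun o => 1 / 2 * chainWeight m r α 0 o

theorem orbitSum_uniformWeight {m r : ℕ} (α : ℝ) (t : Fin 3 → Fin (3 * (m + 1) + r)) :
    orbitSum (uniformWeight m r α) t = 1 / 2 * orbitSum (chainWeight m r α 0) t :=
  orbitSum_mul_const _ _ _

theorem marginal_orbitSum_uniformWeight {m r : ℕ} (α : ℝ) (k : Fin 3)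
    (a : Fin (3 * (m + 1) + r)) :
    ∑ t, (if t k = a then orbitSum (uniformWeight m r α) t else 0) = α / 2 := by
  have h := marginal_orbitSum_chainWeight (m := m) (r := r) α 0 k a
  simp only [zero_div, ite_self, sub_zero] at h
  calc _ = ∑ t, 1 / 2 * (if t k = a then orbitSum (chainWeight m r α 0) t else 0) := by
        refine Finset.sum_congr rfl fun t _ => ?_
        rw [orbitSum_uniformWeight]
        split_ifs <;> simp
    _ = α / 2 := by rw [← Finset.mul_sum, h]; ring

theorem sum_orbitSum_uniformWeight {m r : ℕ} (α : ℝ) :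
    ∑ t, orbitSum (uniformWeight m r α) t = α / 2 * ((3 * (m + 1) + r : ℕ) : ℝ) := by
  have h := sum_orbitSum_chainWeight (m := m) (r := r) α 0
  simp only [orbitSum_uniformWeight, ← Finset.mul_sum, h]
  ring

theorem uniformWeight_nonneg {m r : ℕ} {α : ℝ} (hα : 0 ≤ α) (o : Orbit m r) :
    0 ≤ uniformWeight m r α o :=
  mul_nonneg (by norm_num) (chainWeight_nonneg le_rfl hα o)

/-- With `4 η ≤ α` the chain weights stay above `3/4` of the unperturbed ones. The factor `2/3`
reserves room for rounding. -/
theorem uniformWeight_le {m r : ℕ} {α η : ℝ} (hη : 0 ≤ η) (hηα : 4 * η ≤ α) (o : Orbit m r) :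
    uniformWeight m r α o ≤ 2 / 3 * chainWeight m r α η o := by
  rcases o with i | i | i | j | u <;> simp only [uniformWeight, chainWeight]
  · have : η / 2 ^ (i : ℕ) ≤ η := div_le_self hη (one_le_pow₀ (by norm_num))
    simp only [zero_div]
    linarith
  · simp only [zero_div, mul_zero]; positivity
  · simp only [zero_div, mul_zero]; positivity
  · linarith
  · simp only [zero_div, mul_zero]; positivity

theorem le_orbitSum_uniformWeight {m r : ℕ} {α : ℝ} (hα : 0 ≤ α)
    (t : Fin 3 → Fin (3 * (m + 1) + r)) (ht : orbitSum (uniformWeight m r α) t ≠ 0) :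
    α / 6 ≤ orbitSum (uniformWeight m r α) t := by
  obtain ⟨o, ρ, rfl, ho⟩ := orbitSum_ne_zero ht
  refine le_trans ?_ (le_orbitSum (uniformWeight_nonneg hα) o ρ)
  rcases o with i | i | i | j | u <;> simp [uniformWeight, chainWeight] at ho ⊢ <;> linarith

/-! ### Estimates for the rounded chain tensor. -/

section Parameters

variable {m r N : ℕ} {α η : ℝ}

theorem orbitSum_chainWeight_le_one (hη : 0 ≤ η) (hηα : η ≤ α)
    (hα1 : α * ((3 * (m + 1) + r : ℕ) : ℝ) ≤ 1) (t : Fin 3 → Fin (3 * (m + 1) + r)) :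
    orbitSum (chainWeight m r α η) t ≤ 1 := by
  have h1 := Finset.single_le_sum (f := orbitSum (chainWeight m r α η))
    (fun t _ => orbitSum_nonneg (chainWeight_nonneg hη hηα) t) (Finset.mem_univ t)
  rw [sum_orbitSum_chainWeight] at h1
  have : 0 ≤ η / 2 ^ m := by positivity
  linarith

theorem bitComplexityLE_chainTensor (hN : 1 ≤ N) (hη : 0 ≤ η) (hηα : η ≤ α)
    (hα1 : α * ((3 * (m + 1) + r : ℕ) : ℝ) ≤ 1) (hα : α ≤ 1)
    (t : Fin 3 → Fin (3 * (m + 1) + r)) :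
    BitComplexityLE (chainTensor m r N α η t : ℂ) (5 + 4 * Real.log N) := by
  unfold chainTensor
  split_ifs
  · exact bitComplexityLE_roundSqrt hN hα
  · exact bitComplexityLE_roundSqrt hN (orbitSum_chainWeight_le_one hη hηα hα1 t)

theorem norm_sq_chainTensor_le (e : ℕ) (hN : 1 ≤ N) (hη : 0 ≤ η) (hηα : η ≤ α) :
    ‖liftTuple e (chainTensor m r N α η)‖ ^ 2 ≤ ((3 * (m + 1) + r : ℕ) : ℝ) *
      (α * ((3 * (m + 1) + r : ℕ) : ℝ) + α) := by
  rw [norm_sq_liftTuple]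
  refine mul_le_mul_of_nonneg_left ?_ (Nat.cast_nonneg _)
  have h0 : ∀ t, 0 ≤ orbitSum (chainWeight m r α η) t :=
    orbitSum_nonneg (chainWeight_nonneg hη hηα)
  calc ∑ t, chainTensor m r N α η t ^ 2 ≤ ∑ t, (orbitSum (chainWeight m r α η) t +
        if t = orbitPos (specialOrbit m r) 0 then α else 0) := by
        refine Finset.sum_le_sum fun t _ => ?_
        unfold chainTensor
        split_ifs
        · have := roundSqrt_sq_le hN (hη.trans hηα)
          linarith [h0 t]
        · have := roundSqrt_sq_le hN (h0 t)
          linarith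
    _ = α * ((3 * (m + 1) + r : ℕ) : ℝ) - η / 2 ^ m + α := by
        rw [Finset.sum_add_distrib, sum_orbitSum_chainWeight]
        simp
    _ ≤ _ := by
        have : 0 ≤ η / 2 ^ m := by positivity
        linarith

theorem le_capacity_chainTensor (e : ℕ) (hN : 1 ≤ N) (hη : 0 < η) (hηα : 4 * η ≤ α)
    (hα1 : α * ((3 * (m + 1) + r : ℕ) : ℝ) ≤ 1) (hα : α ≤ 1) (hNα : 2 / (N : ℝ) ≤ α / 12) :
    ((3 * (m + 1) + r : ℕ) : ℝ) * (α / 2 * ((3 * (m + 1) + r : ℕ) : ℝ)) ≤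
      capacity (liftTuple e (chainTensor m r N α η)) := by
  rw [← sum_orbitSum_uniformWeight]
  have hηα' : η ≤ α := by linarith
  refine le_capacity_liftTuple (by omega) _ chainTensor_free _
    (orbitSum_nonneg (uniformWeight_nonneg (by linarith))) (fun t => ?_) (α / 2)
    (marginal_orbitSum_uniformWeight α)
  by_cases h0 : orbitSum (uniformWeight m r α) t = 0
  · rw [h0]; positivity
  have h1 := le_orbitSum_uniformWeight (by linarith) t h0
  have h2 : orbitSum (uniformWeight m r α) t ≤ 2 / 3 * orbitSum (chainWeight m r α η) t := by
    rw [← orbitSum_mul_const]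
    exact orbitSum_mono (uniformWeight_le hη.le hηα) t
  have h3 := orbitSum_chainWeight_le_one hη.le hηα' hα1 t
  unfold chainTensor
  split_ifs with ht
  · have h4 := le_roundSqrt_sq_add hN (show 0 ≤ α by linarith) hα
    rw [ht, orbitSum_special] at h2
    rw [ht]
    linarith
  -- A nonzero uniform weight `u` is at least `α / 6`, so `3u/2 - 2/N ≥ u + α/12 - 2/N ≥ u`.
  · have h4 := le_roundSqrt_sq_add hN (orbitSum_nonneg (chainWeight_nonneg hη.le hηα') t) h3
    linarith

/-- Rounding is downwards, so the error has a sign; at the special position `h` is tuned to make it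
vanish. -/
theorem chainTensor_mass_bounds (hN : 1 ≤ N) (hη : 0 ≤ η) (hηα : η ≤ α)
    (hα1 : α * ((3 * (m + 1) + r : ℕ) : ℝ) ≤ 1) (h : ℝ)
    (hh : roundSqrt N α ^ 2 * Real.exp (2 * -h) = η) (t : Fin 3 → Fin (3 * (m + 1) + r)) :
    0 ≤ orbitSum (chainWeight m r α η) t - chainTensor m r N α η t ^ 2 *
        Real.exp (2 * pairing (chainLie m r h) t) ∧
      orbitSum (chainWeight m r α η) t - chainTensor m r N α η t ^ 2 *
        Real.exp (2 * pairing (chainLie m r h) t) ≤ 2 / N := by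
  have hN' : (0 : ℝ) ≤ 2 / N := by positivity
  by_cases ht : t = orbitPos (specialOrbit m r) 0
  · subst ht
    rw [orbitSum_special, pairing_chainLie, if_pos rfl, chainTensor, if_pos rfl, hh, sub_self]
    exact ⟨le_rfl, hN'⟩
  · have h0 := orbitSum_nonneg (chainWeight_nonneg hη hηα) t
    have h1 := le_roundSqrt_sq_add hN h0 (orbitSum_chainWeight_le_one hη hηα hα1 t)
    have h2 := roundSqrt_sq_le hN h0
    have h3 : chainTensor m r N α η t ^ 2 * Real.exp (2 * pairing (chainLie m r h) t) =
        roundSqrt N (orbitSum (chainWeight m r α η) t) ^ 2 := by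
      have e1 : chainTensor m r N α η t = roundSqrt N (orbitSum (chainWeight m r α η) t) := by
        rw [chainTensor, if_neg ht]
      by_cases hz : chainTensor m r N α η t = 0
      · rw [← e1, hz]; simp
      · rw [pairing_chainLie_of_ne_zero h t hz, if_neg ht, e1]
        simp
    rw [h3]
    constructor <;> linarith

/-- The defect `β` and the rounding loss each count twice: once through the marginals and once
through the total mass, both scaled by `n`. -/
theorem sum_abs_sub_le {n : ℕ} (P p : (Fin 3 → Fin n) → ℝ) (k : Fin 3) (a₀ : Fin n) (α β δ : ℝ)
    (hβ : 0 ≤ β) (hP : ∀ a, ∑ t, (if t k = a then P t else 0) = α - if a = a₀ then β else 0)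
    (hP' : ∑ t, P t = α * n - β) (h0 : ∀ t, 0 ≤ P t - p t) (h1 : ∑ t, (P t - p t) ≤ δ) :
    ∑ a, |n * (∑ t, if t k = a then p t else 0) - ∑ t, p t| ≤ 2 * n * (β + δ) := by
  have hE : ∑ a, ∑ t, (if t k = a then P t - p t else 0) = ∑ t, (P t - p t) := by
    rw [Finset.sum_comm]
    simp
  have hE0 : ∀ a, 0 ≤ ∑ t, (if t k = a then P t - p t else 0) := fun a =>
    Finset.sum_nonneg fun t _ => by split_ifs; exacts [h0 t, le_rfl]
  have hS0 : 0 ≤ ∑ t, (P t - p t) := Finset.sum_nonneg fun t _ => h0 t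
  have hterm : ∀ a, |n * (∑ t, if t k = a then p t else 0) - ∑ t, p t| ≤
      n * (if a = a₀ then β else 0) + β + n * (∑ t, if t k = a then P t - p t else 0) +
        ∑ t, (P t - p t) := by
    intro a
    have e1 : ∑ t, (if t k = a then p t else 0) = (α - if a = a₀ then β else 0) -
        ∑ t, if t k = a then P t - p t else 0 := by
      rw [← hP, ← Finset.sum_sub_distrib]
      refine Finset.sum_congr rfl fun t _ => ?_
      split_ifs <;> ring
    have e2 : ∑ t, p t = α * n - β - ∑ t, (P t - p t) := by
      rw [← hP', ← Finset.sum_sub_distrib]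
      exact Finset.sum_congr rfl fun t _ => by ring
    have h2 : 0 ≤ n * (∑ t, if t k = a then P t - p t else 0) :=
      mul_nonneg (Nat.cast_nonneg n) (hE0 a)
    have h3 : 0 ≤ n * (if a = a₀ then β else 0) :=
      mul_nonneg (Nat.cast_nonneg n) (by split_ifs; exacts [hβ, le_rfl])
    rw [e1, e2, abs_le]
    constructor <;> nlinarith
  refine (Finset.sum_le_sum fun a _ => hterm a).trans ?_
  rw [Finset.sum_add_distrib, Finset.sum_add_distrib, Finset.sum_add_distrib, ← Finset.mul_sum,
    ← Finset.mul_sum, hE]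
  simp only [Finset.sum_ite_eq', Finset.mem_univ, if_true, Finset.sum_const, Finset.card_univ,
    Fintype.card_fin, nsmul_eq_mul]
  have := mul_le_mul_of_nonneg_left h1 (Nat.cast_nonneg (α := ℝ) n)
  linarith

theorem capacity_chainTensor_add_le (e : ℕ) (hN : 1 ≤ N) (hη : 0 < η) (hηα : η ≤ α)
    (hα1 : α * ((3 * (m + 1) + r : ℕ) : ℝ) ≤ 1)
    (hNη : ((3 * (m + 1) + r : ℕ) : ℝ) ^ 3 * (2 / N) ≤ η / 2 ^ m) (h : ℝ) (h0 : 0 < h)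
    (hh : roundSqrt N α ^ 2 * Real.exp (2 * -h) = η) :
    capacity (liftTuple e (chainTensor m r N α η)) + ((3 * (m + 1) + r : ℕ) : ℝ) * η ≤
      ⨅ g : geodesicBall (3 * (m + 1) + r) (3 + e) (h * 2 ^ m / 12),
        ‖actTuple (g : SLPow (3 * (m + 1) + r) (3 + e))
          (liftTuple e (chainTensor m r N α η))‖ ^ 2 := by
  set p : (Fin 3 → Fin (3 * (m + 1) + r)) → ℝ := fun t =>
    chainTensor m r N α η t ^ 2 * Real.exp (2 * pairing (chainLie m r h) t) with hp
  have hb := chainTensor_mass_bounds hN hη.le hηα hα1 h hh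
  refine capacity_liftTuple_add_le (by omega) _ chainTensor_free (chainLie m r h)
    (sum_chainLie m r h) h h0 (fun t ht => ?_) η p (fun t => rfl) ?_ _ (by positivity) ?_
  · rw [pairing_chainLie_of_ne_zero h t ht]
    split_ifs <;> simp
  · rw [Finset.sum_eq_single (orbitPos (specialOrbit m r) 0)]
    · rw [pairing_chainLie, if_pos rfl, if_pos rfl, hp]
      simp only [pairing_chainLie, if_true, chainTensor]
      exact hh
    · intro t _ ht
      by_cases hz : chainTensor m r N α η t = 0
      · simp [hp, hz]
      · rw [pairing_chainLie_of_ne_zero h t hz, if_neg ht, if_neg (by linarith)]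
    · simp
  · have hδ : ∑ t, (orbitSum (chainWeight m r α η) t - p t) ≤ η / 2 ^ m := by
      refine le_trans (Finset.sum_le_sum fun t _ => (hb t).2) (le_trans (le_of_eq ?_) hNη)
      simp
    have hk : ∀ k : Fin 3, ∑ a, |((3 * (m + 1) + r : ℕ) : ℝ) *
        (∑ t, if t k = a then p t else 0) - ∑ t, p t| ≤
        2 * ((3 * (m + 1) + r : ℕ) : ℝ) * (η / 2 ^ m + η / 2 ^ m) := fun k =>
      sum_abs_sub_le (orbitSum (chainWeight m r α η)) p k _ α (η / 2 ^ m) (η / 2 ^ m)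
        (by positivity) (marginal_orbitSum_chainWeight α η k) (sum_orbitSum_chainWeight α η)
        (fun t => (hb t).1) hδ
    -- The `12` is three factors times `2`, times the two equal contributions `η / 2^m` of chain
    -- defect and rounding.
    calc h * 2 ^ m / 12 * ∑ k, ∑ a, |((3 * (m + 1) + r : ℕ) : ℝ) *
          (∑ t, if t k = a then p t else 0) - ∑ t, p t| ≤
        h * 2 ^ m / 12 * ∑ k : Fin 3, 2 * ((3 * (m + 1) + r : ℕ) : ℝ) *
          (η / 2 ^ m + η / 2 ^ m) :=
          mul_le_mul_of_nonneg_left (Finset.sum_le_sum fun k _ => hk k) (by positivity)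
      _ = h * (((3 * (m + 1) + r : ℕ) : ℝ) * η) := by
          simp only [Finset.sum_const, Finset.card_univ, Fintype.card_fin, nsmul_eq_mul]
          field_simp
          push_cast
          ring

end Parameters

/-! ### The case `n = 2`. -/

/-- The position `(0, 1, 1 - l, …, 1 - l)`. -/
def pairPos (e : ℕ) (l : Fin 2) : Fin (3 + e) → Fin 2 :=
  Fin.append ![0, 1, 1 - l] fun _ => 1 - l

theorem const_ne_pairPos (e : ℕ) (l : Fin 2) : (fun _ => l) ≠ pairPos e l := by
  intro h
  have := congrFun h (Fin.castAdd e 2)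
  simp only [pairPos, Fin.append_left] at this
  fin_cases l <;> simp at this

/-- The pair `w_l = (e_l ⊗ ⋯ ⊗ e_l + e_0 ⊗ e_1 ⊗ e_{1-l} ⊗ ⋯ ⊗ e_{1-l}) / 2`. -/
noncomputable def pairTuple (e : ℕ) : TensorTuple 2 2 (3 + e) :=
  WithLp.toLp 2 fun l => WithLp.toLp 2 fun i =>
    if i = (fun _ => l) ∨ i = pairPos e l then 1 / 2 else 0

theorem pairTuple_apply (e : ℕ) (l : Fin 2) (i : Fin (3 + e) → Fin 2) :
    pairTuple e l i = if i = (fun _ => l) ∨ i = pairPos e l then 1 / 2 else 0 := rfl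

theorem pairTuple_ne_zero {e : ℕ} {l : Fin 2} {i : Fin (3 + e) → Fin 2}
    (h : pairTuple e l i ≠ 0) : i = (fun _ => l) ∨ i = pairPos e l := by
  rw [pairTuple_apply] at h
  by_contra h'
  exact h (if_neg h')

theorem exists_ne_const_ne_pairPos (e : ℕ) (l : Fin 2) (k : Fin (3 + e)) :
    ∃ k', k' ≠ k ∧ l ≠ pairPos e l k' := by
  have h2 : l ≠ pairPos e l (Fin.castAdd e 2) := by
    simp only [pairPos, Fin.append_left]
    fin_cases l <;> simp
  by_cases hk : Fin.castAdd e 2 = k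
  · subst hk
    fin_cases l
    · exact ⟨Fin.castAdd e 1, by simp, by simp [pairPos]⟩
    · exact ⟨Fin.castAdd e 0, by simp [Fin.ext_iff], by simp [pairPos]⟩
  · exact ⟨_, hk, h2⟩

theorem isFree_pairTuple (e : ℕ) : IsFree (pairTuple e) := by
  intro l i j hi hj k hk
  obtain ⟨k', hk', hne⟩ := exists_ne_const_ne_pairPos e l k
  rcases pairTuple_ne_zero hi with rfl | rfl <;> rcases pairTuple_ne_zero hj with rfl | rfl
  · rfl
  · exact absurd (hk k' hk') hne
  · exact absurd (hk k' hk').symm hne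
  · rfl

theorem norm_sq_pairTuple_apply (e : ℕ) (l : Fin 2) (i : Fin (3 + e) → Fin 2) :
    ‖pairTuple e l i‖ ^ 2 =
      (if i = (fun _ => l) then 1 / 4 else 0) + (if i = pairPos e l then 1 / 4 else 0) := by
  have hne := const_ne_pairPos e l
  rw [pairTuple_apply]
  by_cases h1 : i = fun _ => l
  · subst h1; simp [hne]; norm_num
  · by_cases h2 : i = pairPos e l
    · subst h2; simp [hne.symm]; norm_num
    · simp [h1, h2]

theorem norm_sq_pairTuple (e : ℕ) : ‖pairTuple e‖ ^ 2 = 1 := by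
  rw [norm_sq_tuple]
  have : ∀ l, ‖pairTuple e l‖ ^ 2 = 1 / 2 := by
    intro l
    rw [EuclideanSpace.norm_sq_eq]
    simp only [norm_sq_pairTuple_apply, Finset.sum_add_distrib, Finset.sum_ite_eq',
      Finset.mem_univ, if_true]
    norm_num
  simp [this]

theorem numNonzero_pairTuple_le (e : ℕ) : numNonzero (pairTuple e) ≤ 4 := by
  have hsub : {p : Fin 2 × (Fin (3 + e) → Fin 2) | pairTuple e p.1 p.2 ≠ 0} ⊆
      (fun q : Fin 2 × Bool => (q.1, if q.2 then (fun _ => q.1) else pairPos e q.1)) ''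
        Set.univ := by
    rintro ⟨l, i⟩ hi
    have hi' : pairTuple e l i ≠ 0 := hi
    rcases pairTuple_ne_zero hi' with rfl | rfl
    · exact ⟨(l, true), trivial, by simp⟩
    · exact ⟨(l, false), trivial, by simp⟩
  calc numNonzero (pairTuple e) ≤ _ := Set.ncard_le_ncard hsub (Set.toFinite _)
    _ ≤ (Set.univ : Set (Fin 2 × Bool)).ncard := Set.ncard_image_le (Set.toFinite _)
    _ = 4 := by rw [Set.ncard_univ]; simp

/-- The constant positions alone already have uniform marginals, with total weight `1/2`. -/
theorem half_le_capacity_pairTuple (e : ℕ) : 1 / 2 ≤ capacity (pairTuple e) := by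
  have h := le_capacity_of_uniform_marginals (pairTuple e) (isFree_pairTuple e) two_ne_zero
    (fun l i => if i = (fun _ => l) then 1 / 4 else 0)
    (fun l i => by split_ifs <;> norm_num)
    (fun l i => by
      rw [norm_sq_pairTuple_apply]
      have : (0 : ℝ) ≤ if i = pairPos e l then 1 / 4 else 0 := by split_ifs <;> norm_num
      linarith)
    (fun _ => 1 / 4)
    (fun k a => by
      have : ∀ l : Fin 2, ∑ i : Fin (3 + e) → Fin 2, (if i k = a then
          (if i = (fun _ => l) then (1 / 4 : ℝ) else 0) else 0) = if l = a then 1 / 4 else 0 := by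
        intro l
        rw [Finset.sum_eq_single fun _ => l]
        · simp
        · intro i _ hi; simp [hi]
        · simp
      rw [marginal, Finset.sum_congr rfl fun l _ => this l]
      simp)
  simp only [Finset.sum_ite_eq', Finset.mem_univ, if_true, Finset.sum_const, Finset.card_univ,
    Fintype.card_fin, nsmul_eq_mul] at h
  linarith

/-- The direction along which the positions `pairPos` decay. -/
noncomputable def pairLie (e : ℕ) (h : ℝ) : Fin (3 + e) → Fin 2 → ℝ :=
  Fin.append ![![-h / 2, h / 2], ![h / 2, -h / 2], ![0, 0]] fun _ _ => 0

theorem sum_pairLie (e : ℕ) (h : ℝ) (k : Fin (3 + e)) : ∑ a, pairLie e h k a = 0 := by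
  induction k using Fin.addCases with
  | left k => fin_cases k <;> simp [pairLie] <;> ring
  | right k => simp [pairLie]

theorem pairing_pairLie_const (e : ℕ) (h : ℝ) (l : Fin 2) :
    pairing (pairLie e h) (fun _ => l) = 0 := by
  simp only [pairing, Fin.sum_univ_add, pairLie, Fin.append_left, Fin.append_right,
    Fin.sum_univ_three]
  fin_cases l <;> simp [neg_div]

theorem pairing_pairLie_pairPos (e : ℕ) (h : ℝ) (l : Fin 2) :
    pairing (pairLie e h) (pairPos e l) = -h := by
  simp only [pairing, Fin.sum_univ_add, pairLie, pairPos, Fin.append_left, Fin.append_right,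
    Fin.sum_univ_three]
  fin_cases l <;> simp

theorem mass_pairTuple (e : ℕ) (h η : ℝ) (hh : 1 / 4 * Real.exp (2 * -h) = η / 2) (l : Fin 2)
    (i : Fin (3 + e) → Fin 2) : mass (pairTuple e) (pairLie e h) l i =
      (if i = (fun _ => l) then 1 / 4 else 0) + (if i = pairPos e l then η / 2 else 0) := by
  have hne := const_ne_pairPos e l
  rw [mass, norm_sq_pairTuple_apply]
  by_cases h1 : i = fun _ => l
  · subst h1; simp [hne, pairing_pairLie_const]
  · by_cases h2 : i = pairPos e l
    · subst h2
      rw [if_neg hne.symm, if_pos rfl, if_pos rfl, pairing_pairLie_pairPos]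
      simpa using hh
    · simp [h1, h2]

theorem marginal_mass_pairTuple (e : ℕ) (h η : ℝ) (hh : 1 / 4 * Real.exp (2 * -h) = η / 2)
    (k : Fin (3 + e)) (a : Fin 2) : marginal (mass (pairTuple e) (pairLie e h)) k a =
      1 / 4 + ∑ l, if pairPos e l k = a then η / 2 else 0 := by
  have h1 : ∀ l, ∑ i, (if i k = a then mass (pairTuple e) (pairLie e h) l i else 0) =
      (if l = a then 1 / 4 else 0) + if pairPos e l k = a then η / 2 else 0 := by
    intro l
    have : ∀ i, (if i k = a then mass (pairTuple e) (pairLie e h) l i else 0) =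
        (if i = (fun _ => l) then if l = a then 1 / 4 else 0 else 0) +
        (if i = pairPos e l then if pairPos e l k = a then η / 2 else 0 else 0) := by
      intro i
      rw [mass_pairTuple e h η hh, ite_add_zero]
      congr 1
      · by_cases h1 : i = fun _ => l
        · subst h1; simp
        · simp [h1]
      · by_cases h2 : i = pairPos e l
        · subst h2; simp
        · simp [h2]
    simp only [this, Finset.sum_add_distrib, Finset.sum_ite_eq', Finset.mem_univ, if_true]
  simp only [marginal, h1, Finset.sum_add_distrib, Finset.sum_ite_eq', Finset.mem_univ, if_true]

theorem capacity_pairTuple_add_le (e : ℕ) (h η : ℝ) (hη : 0 < η) (h0 : 0 < h)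
    (hh : 1 / 4 * Real.exp (2 * -h) = η / 2) :
    capacity (pairTuple e) + η ≤ ⨅ g : geodesicBall 2 (3 + e) (h / 2),
      ‖actTuple (g : SLPow 2 (3 + e)) (pairTuple e)‖ ^ 2 := by
  have hM : ∑ l, ∑ i, mass (pairTuple e) (pairLie e h) l i = 1 / 2 + η := by
    simp only [mass_pairTuple e h η hh, Finset.sum_add_distrib, Finset.sum_ite_eq',
      Finset.mem_univ, if_true, Finset.sum_const, Finset.card_univ, Fintype.card_fin,
      nsmul_eq_mul]
    push_cast
    ring
  refine capacity_add_le_iInf_geodesicBall _ (isFree_pairTuple e) (pairLie e h) (sum_pairLie e h)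
    h h0 (fun l i hi => ?_) η ?_ _ (by positivity) ?_
  · rcases pairTuple_ne_zero hi with rfl | rfl
    · exact Or.inl (pairing_pairLie_const e h l)
    · exact Or.inr (pairing_pairLie_pairPos e h l)
  · have : ∀ l i, (if pairing (pairLie e h) i = -h then
        mass (pairTuple e) (pairLie e h) l i else 0) = if i = pairPos e l then η / 2 else 0 := by
      intro l i
      rw [mass_pairTuple e h η hh]
      by_cases h1 : i = fun _ => l
      · subst h1
        rw [pairing_pairLie_const, if_neg (by linarith), if_neg (const_ne_pairPos e l)]
      · by_cases h2 : i = pairPos e l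
        · subst h2
          rw [pairing_pairLie_pairPos, if_pos rfl, if_neg h1, zero_add]
        · simp [h1, h2]
    simp only [this, Finset.sum_ite_eq', Finset.mem_univ, if_true, Finset.sum_const,
      Finset.card_univ, Fintype.card_fin, nsmul_eq_mul]
    push_cast
    ring
  -- Taking both `l` balances all factors but the first two; these contribute four deviations `η /
  -- 2`, so radius `h / 2` meets the criterion with equality.
  · rw [hM]
    simp only [marginal_mass_pairTuple e h η hh]
    rw [Fin.sum_univ_add]
    have hz : ∀ x : ℝ, (1 / 4 + x) - (1 / 2 + η) / ((2 : ℕ) : ℝ) = x - η / 2 := fun x => by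
      push_cast; ring
    simp only [hz, pairPos, Fin.append_left, Fin.append_right, Fin.sum_univ_three,
      Fin.sum_univ_two]
    have hη2 : |η / 2| = η / 2 := abs_of_pos (by linarith)
    have hη3 : |η - η / 2| = η / 2 := by rw [sub_half, hη2]
    simp [hη2, hη3]
    linarith

/-! ### Choice of parameters and conclusion. -/

theorem pow_mul_le_one {n : ℕ} (hn : 2 ≤ n) {ε : ℝ}
    (hε : ε ≤ Real.exp (-3 * (n : ℝ) ^ 2 * Real.log n)) : (n : ℝ) ^ (n + 5) * ε ≤ 1 := by
  have hn' : (2 : ℝ) ≤ n := by exact_mod_cast hn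
  have h0 : (0 : ℝ) < n := by linarith
  have hlog : 0 ≤ Real.log n := Real.log_nonneg (by linarith)
  calc (n : ℝ) ^ (n + 5) * ε ≤ (n : ℝ) ^ (n + 5) * Real.exp (-3 * (n : ℝ) ^ 2 * Real.log n) :=
        mul_le_mul_of_nonneg_left hε (by positivity)
    _ = Real.exp (((n : ℝ) + 5 - 3 * (n : ℝ) ^ 2) * Real.log n) := by
        rw [← Real.exp_log (pow_pos h0 (n + 5)), Real.log_pow, ← Real.exp_add]
        push_cast
        congr 1
        ring
    _ ≤ Real.exp 0 := by
        refine Real.exp_le_exp.mpr (mul_nonpos_of_nonpos_of_nonneg ?_ hlog)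
        nlinarith
    _ = 1 := Real.exp_zero

/-- Giving up half of `log (1 / ε)` absorbs the polynomial factors in `n` in the formula for `h`. -/
theorem quarter_log_le_half_log {x ε : ℝ} (hε : 0 < ε) (h : 1 ≤ x ^ 2 * ε) :
    1 / 4 * Real.log (1 / ε) ≤ 1 / 2 * Real.log x := by
  have h1 : 1 / ε ≤ x ^ 2 := by rwa [div_le_iff₀ hε]
  have h2 := Real.log_le_log (by positivity) h1
  rw [Real.log_pow] at h2
  push_cast at h2
  linarith

theorem mul_exp_neg_log_div {s η : ℝ} (hs : 0 < s) (hη : 0 < η) :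
    s * Real.exp (2 * -(1 / 2 * Real.log (s / η))) = η := by
  rw [show 2 * -(1 / 2 * Real.log (s / η)) = -Real.log (s / η) by ring, Real.exp_neg,
    Real.exp_log (by positivity)]
  field_simp

theorem one_le_log_inv {ε : ℝ} (hε : 0 < ε) (h : 128 * ε ≤ 1) : 1 ≤ Real.log (1 / ε) := by
  rw [Real.le_log_iff_exp_le (by positivity), le_div_iff₀ hε]
  have := Real.exp_one_lt_d9
  nlinarith

/-- There is a sparse tuple with entries of small bit complexity that is far from its capacity on a
geodesic ball of radius at least `c 2^(n/3) log (1/ε)`. -/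
def HasDiameterGap (c K : ℝ) (n d : ℕ) (ε : ℝ) : Prop :=
  ∃ w : TensorTuple n n d,
    ((numNonzero w : ℕ) : ℝ) ≤ K * (n : ℝ) ^ 2 ∧
    (∀ (l : Fin n) (i : Fin d → Fin n), w l i ≠ 0 →
      BitComplexityLE (w l i) (K * (Real.log (n : ℝ) + Real.log (1 / ε)))) ∧
    (∃ R : ℝ, c * (2 : ℝ) ^ ((n : ℝ) / 3) * Real.log (1 / ε) ≤ R ∧
      capacity w + ε ≤
        ⨅ g : geodesicBall n d R, ‖actTuple (g : SLPow n d) w‖ ^ 2) ∧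
    1 / 4 ≤ capacity w ∧ capacity w ≤ 1 ∧ 1 / 2 ≤ ‖w‖ ∧ ‖w‖ ≤ 1

theorem hasDiameterGap_two (e : ℕ) {ε : ℝ} (hε : 0 < ε) (hε1 : 128 * ε ≤ 1) :
    HasDiameterGap (1 / 192) 20 2 (3 + e) ε := by
  have hL := one_le_log_inv hε hε1
  have hn := norm_sq_pairTuple e
  have hn1 : ‖pairTuple e‖ = 1 := (pow_eq_one_iff_of_nonneg (norm_nonneg _) two_ne_zero).mp hn
  have hcap := half_le_capacity_pairTuple e
  have hcap1 := capacity_le_norm_sq (pairTuple e)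
  have hl2 : 0 ≤ Real.log ((2 : ℕ) : ℝ) := Real.log_nonneg (by norm_num)
  have hl3 : Real.log ((2 : ℕ) : ℝ) ≤ 1 := by
    have := Real.log_two_lt_d9
    push_cast
    linarith
  refine ⟨pairTuple e, ?_, fun l i hi => ?_, ?_, by linarith, by linarith, by linarith, by linarith⟩
  · have : (numNonzero (pairTuple e) : ℝ) ≤ 4 := by exact_mod_cast numNonzero_pairTuple_le e
    push_cast
    linarith
  · have h1 : pairTuple e l i = ((((1 : ℕ) : ℝ) / (2 : ℕ) : ℝ) : ℂ) := by
      rw [pairTuple_apply, if_pos (pairTuple_ne_zero hi)]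
      push_cast
      ring
    rw [h1]
    refine (bitComplexityLE_div (by norm_num) (by norm_num)).mono ?_
    push_cast at hl2 hl3 ⊢
    linarith
  · set h := 1 / 2 * Real.log ((1 / 4) / (ε / 2)) with hh
    have hh1 : 1 / 4 * Real.log (1 / ε) ≤ h := by
      refine quarter_log_le_half_log hε ?_
      rw [show ((1 : ℝ) / 4 / (ε / 2)) ^ 2 * ε = 1 / (4 * ε) by field_simp; norm_num]
      rw [le_div_iff₀ (by positivity)]
      linarith
    refine ⟨h / 2, ?_, capacity_pairTuple_add_le e h ε hε (by linarith)
      (mul_exp_neg_log_div (by norm_num) (by positivity))⟩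
    have h2 : (2 : ℝ) ^ (((2 : ℕ) : ℝ) / 3) ≤ (2 : ℝ) ^ (1 : ℝ) :=
      Real.rpow_le_rpow_of_exponent_le (by norm_num) (by norm_num)
    rw [Real.rpow_one] at h2
    have h3 := mul_le_mul_of_nonneg_right h2 (show 0 ≤ Real.log (1 / ε) by linarith)
    linarith

/-- `α = 1/(2n²)` normalizes the tuple and `η = ε/n` makes the gap of the `n` copies equal to `ε`.
`N = ⌈1/ε²⌉` keeps the total rounding error below `η / 2^m`, since `ε` beats `2 n⁴ 2^m`. -/
theorem exists_chain_parameters {n m : ℕ} (hn : 3 ≤ n) (hm : m ≤ n) {ε : ℝ} (hε : 0 < ε)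
    (hε1 : (n : ℝ) ^ (n + 5) * ε ≤ 1) :
    ∃ (N : ℕ) (α η : ℝ), 1 ≤ N ∧ Real.log N ≤ 1 + 2 * Real.log (1 / ε) ∧ 0 < η ∧ 4 * η ≤ α ∧
      α ≤ 1 ∧ α * n ≤ 1 ∧ α * n * n = 1 / 2 ∧ n * η = ε ∧ 2 / (N : ℝ) ≤ α / 12 ∧
      (n : ℝ) ^ 3 * (2 / N) ≤ η / 2 ^ m ∧ 1 ≤ (α / 2 / η) ^ 2 * ε ∧ 1 ≤ Real.log (1 / ε) := by
  have hn3 : (3 : ℝ) ≤ n := by exact_mod_cast hn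
  have hn0 : (0 : ℝ) < n := by linarith
  have hn1 : (1 : ℝ) ≤ n := by linarith
  have s1 : 729 * (n : ℝ) ^ 2 * ε ≤ 1 := by
    refine le_trans (mul_le_mul_of_nonneg_right ?_ hε.le) hε1
    calc 729 * (n : ℝ) ^ 2 = 3 ^ 6 * (n : ℝ) ^ 2 := by norm_num
      _ ≤ (n : ℝ) ^ 6 * (n : ℝ) ^ 2 :=
          mul_le_mul_of_nonneg_right (pow_le_pow_left₀ (by norm_num) hn3 6) (by positivity)
      _ = (n : ℝ) ^ 8 := by ring
      _ ≤ (n : ℝ) ^ (n + 5) := pow_le_pow_right₀ hn1 (by omega)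
  have s2 : 2 * (n : ℝ) ^ 4 * 2 ^ m * ε ≤ 1 := by
    refine le_trans (mul_le_mul_of_nonneg_right ?_ hε.le) hε1
    calc 2 * (n : ℝ) ^ 4 * 2 ^ m ≤ n * (n : ℝ) ^ 4 * n ^ m := by
          gcongr <;> linarith
      _ = (n : ℝ) ^ (m + 5) := by ring
      _ ≤ (n : ℝ) ^ (n + 5) := pow_le_pow_right₀ hn1 (by omega)
  have s3 : 128 * ε ≤ 1 := by nlinarith
  have s4 : ε ≤ 1 := by linarith
  have s5 : 729 * (n : ℝ) * ε ≤ 1 := by nlinarith [mul_pos hn0 hε]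
  have hL := one_le_log_inv hε s3
  set N := ⌈1 / ε ^ 2⌉₊ with hN
  have hNge : 1 / ε ^ 2 ≤ N := Nat.le_ceil _
  have hNpos : (0 : ℝ) < N := lt_of_lt_of_le (by positivity) hNge
  have hN1 : 1 ≤ N := by exact_mod_cast hNpos
  have hNinv : 2 / (N : ℝ) ≤ 2 * ε ^ 2 := by
    rw [div_le_iff₀ hNpos]
    rw [div_le_iff₀ (by positivity)] at hNge
    linarith
  have hNlog : Real.log N ≤ 1 + 2 * Real.log (1 / ε) := by
    have h1 : (N : ℝ) ≤ 2 * (1 / ε) ^ 2 := by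
      have h2 := (Nat.ceil_lt_add_one (show 0 ≤ 1 / ε ^ 2 by positivity)).le
      have h3 : 1 ≤ 1 / ε ^ 2 := by
        rw [le_div_iff₀ (by positivity), one_mul]
        exact pow_le_one₀ hε.le s4
      rw [_root_.one_div_pow]
      linarith
    have h4 := Real.log_le_log hNpos h1
    rw [Real.log_mul (by norm_num) (by positivity), Real.log_pow] at h4
    have := Real.log_two_lt_d9
    push_cast at h4
    linarith
  obtain ⟨α, hα⟩ : ∃ α : ℝ, α = 1 / (2 * (n : ℝ) ^ 2) := ⟨_, rfl⟩
  obtain ⟨η, hη⟩ : ∃ η : ℝ, η = ε / n := ⟨_, rfl⟩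
  have hαpos : 0 < α := by rw [hα]; positivity
  have hηpos : 0 < η := by rw [hη]; positivity
  have hαn : α * n * n = 1 / 2 := by rw [hα]; field_simp
  have hηn : n * η = ε := by rw [hη]; field_simp
  have hηα : 4 * η ≤ α := by
    rw [hη, hα, ← mul_div_assoc, div_le_div_iff₀ hn0 (by positivity)]
    nlinarith
  have hα1 : α * n ≤ 1 := by nlinarith [mul_pos hαpos hn0]
  have hα2 : α ≤ 1 := by nlinarith [mul_pos hαpos hn0]
  have hNα : 2 / (N : ℝ) ≤ α / 12 := by
    refine hNinv.trans ?_
    rw [hα, div_div, le_div_iff₀ (by positivity)]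
    nlinarith
  have hNη : (n : ℝ) ^ 3 * (2 / N) ≤ η / 2 ^ m := by
    calc (n : ℝ) ^ 3 * (2 / N) ≤ (n : ℝ) ^ 3 * (2 * ε ^ 2) :=
          mul_le_mul_of_nonneg_left hNinv (by positivity)
      _ ≤ η / 2 ^ m := by
          rw [hη, div_div, le_div_iff₀ (by positivity)]
          calc (n : ℝ) ^ 3 * (2 * ε ^ 2) * (n * 2 ^ m) = (2 * (n : ℝ) ^ 4 * 2 ^ m * ε) * ε := by
                ring
            _ ≤ 1 * ε := mul_le_mul_of_nonneg_right s2 hε.le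
            _ = ε := one_mul ε
  refine ⟨N, α, η, hN1, hNlog, hηpos, hηα, hα2, hα1, hαn, hηn, hNα, hNη, ?_, hL⟩
  rw [hα, hη, show (1 / (2 * (n : ℝ) ^ 2) / 2 / (ε / n)) ^ 2 * ε = 1 / (16 * (n : ℝ) ^ 2 * ε) by
    field_simp; norm_num, le_div_iff₀ (by positivity)]
  nlinarith [mul_pos (pow_pos hn0 2) hε]

theorem two_rpow_div_three_le {m r : ℕ} (hr : r < 3) :
    (2 : ℝ) ^ (((3 * (m + 1) + r : ℕ) : ℝ) / 3) ≤ 4 * 2 ^ m := by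
  calc (2 : ℝ) ^ (((3 * (m + 1) + r : ℕ) : ℝ) / 3) ≤ (2 : ℝ) ^ ((m + 2 : ℕ) : ℝ) := by
        refine Real.rpow_le_rpow_of_exponent_le (by norm_num) ?_
        have : ((3 * (m + 1) + r : ℕ) : ℝ) ≤ ((3 * (m + 2) : ℕ) : ℝ) := by
          exact_mod_cast (by omega)
        push_cast at this ⊢
        linarith
    _ = 4 * 2 ^ m := by rw [Real.rpow_natCast]; ring

theorem hasDiameterGap_chain (m r e : ℕ) (hr : r < 3) {ε : ℝ} (hε : 0 < ε)
    (hε1 : ((3 * (m + 1) + r : ℕ) : ℝ) ^ (3 * (m + 1) + r + 5) * ε ≤ 1) :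
    HasDiameterGap (1 / 192) 20 (3 * (m + 1) + r) (3 + e) ε := by
  obtain ⟨N, α, η, hN1, hNlog, hη, hηα, hα2, hα1, hαn, hηn, hNα, hNη, hε2, hL⟩ :=
    exists_chain_parameters (m := m) (by omega) (by omega) hε hε1
  have hn1 : (1 : ℝ) ≤ (3 * (m + 1) + r : ℕ) := by exact_mod_cast (by omega)
  have hcaplow := le_capacity_chainTensor (m := m) (r := r) e hN1 hη hηα hα1 hα2 hNα
  have hcapup := capacity_le_norm_sq (liftTuple e (chainTensor m r N α η))
  have hup := norm_sq_chainTensor_le (m := m) (r := r) (α := α) (η := η) e hN1 hη.le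
    (by linarith)
  have hgap := capacity_chainTensor_add_le (m := m) (r := r) (α := α) (η := η) e hN1 hη
    (by linarith) hα1 hNη (1 / 2 * Real.log (roundSqrt N α ^ 2 / η))
  have hbits := bitComplexityLE_chainTensor (m := m) (r := r) hN1 hη.le
    (by linarith : η ≤ α) hα1 hα2
  have hnum := numNonzero_chainTensor_le m r N e α η
  have hrpow := two_rpow_div_three_le (m := m) hr
  have hz1 : α / 2 ≤ roundSqrt N α ^ 2 := by
    have := le_roundSqrt_sq_add hN1 (show 0 ≤ α by linarith) hα2
    linarith
  have hh : 1 / 4 * Real.log (1 / ε) ≤ 1 / 2 * Real.log (roundSqrt N α ^ 2 / η) := by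
    have h1 : α / 2 / η ≤ roundSqrt N α ^ 2 / η := div_le_div_of_nonneg_right hz1 hη.le
    have h2 : 0 < α / 2 / η := div_pos (by linarith) hη
    have h3 := Real.log_le_log h2 h1
    linarith [quarter_log_le_half_log hε hε2]
  replace hgap := hgap (by linarith) (mul_exp_neg_log_div (by linarith) hη)
  rw [hηn] at hgap
  have hlow : (1 : ℝ) / 4 ≤ capacity (liftTuple e (chainTensor m r N α η)) :=
    le_trans (by linarith) hcaplow
  replace hup : ‖liftTuple e (chainTensor m r N α η)‖ ^ 2 ≤ 1 := by
    have h1 := le_mul_of_one_le_right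
      (mul_nonneg (show 0 ≤ α by linarith) (zero_le_one.trans hn1)) hn1
    linarith
  refine ⟨liftTuple e (chainTensor m r N α η), ?_, fun l i hi => ?_, ⟨_, ?_, hgap⟩, hlow,
    hcapup.trans hup, ?_, ?_⟩
  · have h1 : (numNonzero (liftTuple e (chainTensor m r N α η)) : ℝ) ≤
        ((3 * (m + 1) + r : ℕ) : ℝ) * (3 * ((3 * (m + 1) + r : ℕ) : ℝ)) := by
      exact_mod_cast hnum
    refine h1.trans ?_
    nlinarith
  · obtain ⟨t, rfl, -⟩ := exists_of_liftTuple_ne_zero hi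
    rw [liftTuple_apply, liftFun_liftPos]
    refine (hbits t).mono ?_
    have := Real.log_nonneg hn1
    linarith
  -- `192 = 4 · 4 · 12`: from `2^(n/3) ≤ 4 · 2^m`, from `h ≥ log(1/ε) / 4`, and from the radius `h
  -- 2^m / 12`.
  · calc 1 / 192 * (2 : ℝ) ^ (((3 * (m + 1) + r : ℕ) : ℝ) / 3) * Real.log (1 / ε) ≤
          1 / 192 * (4 * 2 ^ m) * Real.log (1 / ε) :=
          mul_le_mul_of_nonneg_right (mul_le_mul_of_nonneg_left hrpow (by norm_num))
            (by linarith)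
      _ = 1 / 4 * Real.log (1 / ε) * 2 ^ m / 12 := by ring
      _ ≤ _ := div_le_div_of_nonneg_right
          (mul_le_mul_of_nonneg_right hh (by positivity)) (by norm_num)
  -- The norm bound follows from `1/4 ≤ cap ≤ ‖w‖²`.
  · refine le_of_sq_le_sq ?_ (norm_nonneg _)
    linarith
  · exact (sq_le_one_iff₀ (norm_nonneg _)).mp hup

end TensorScaling

theorem mainTheorem10 :
    ∃ C c K : ℝ, 0 < C ∧ 0 < c ∧ 0 < K ∧
      ∀ (d n : ℕ), 3 ≤ d → 2 ≤ n →
        ∀ ε : ℝ, 0 < ε → ε ≤ Real.exp (-C * (n : ℝ) ^ 2 * Real.log (n : ℝ)) →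
          ∃ w : TensorScaling.TensorTuple n n d,
            ((TensorScaling.numNonzero w : ℕ) : ℝ) ≤ K * (n : ℝ) ^ 2 ∧
            (∀ (l : Fin n) (i : Fin d → Fin n), w l i ≠ 0 →
              TensorScaling.BitComplexityLE (w l i) (K * (Real.log (n : ℝ) + Real.log (1 / ε)))) ∧
            (∃ R : ℝ, c * (2 : ℝ) ^ ((n : ℝ) / 3) * Real.log (1 / ε) ≤ R ∧
              TensorScaling.capacity w + ε ≤
                ⨅ g : TensorScaling.geodesicBall n d R,
                  ‖TensorScaling.actTuple (g : TensorScaling.SLPow n d) w‖ ^ 2) ∧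
            1 / 4 ≤ TensorScaling.capacity w ∧ TensorScaling.capacity w ≤ 1 ∧
            1 / 2 ≤ ‖w‖ ∧ ‖w‖ ≤ 1 := by
  -- `C = 3` is enough since `n + 5 ≤ 3 n²` for `n ≥ 2`, which yields `n^(n+5) ε ≤ 1`; for `n = 2`
  -- this reads `128 ε ≤ 1`.
  refine ⟨3, 1 / 192, 20, by norm_num, by norm_num, by norm_num, fun d n hd hn ε hε hε1 => ?_⟩
  obtain ⟨e, rfl⟩ := Nat.exists_eq_add_of_le hd
  have hpow := TensorScaling.pow_mul_le_one hn hε1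
  change TensorScaling.HasDiameterGap (1 / 192) 20 n (3 + e) ε
  rcases hn.eq_or_lt with rfl | hn3
  · refine TensorScaling.hasDiameterGap_two e hε ?_
    norm_num at hpow
    exact hpow
  · obtain ⟨m, r, hr, rfl⟩ : ∃ m r, r < 3 ∧ n = 3 * (m + 1) + r :=
      ⟨n / 3 - 1, n % 3, Nat.mod_lt _ (by norm_num), by omega⟩
    exact TensorScaling.hasDiameterGap_chain m r e hr hε hpow
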